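/- Let $\log^* N$ denote the base-2 iterated logarithm (the least $k$ such that applying $\log_2$ to $N$ at most $k$ times gives a value $\le 1$). For a finite nonempty totally ordered set $X$ and $\ell\in\mathbb N$, let $\mathrm{THRESH}_X^{\ell}=\{c_a : a\in X^\ell\}$, where $c_a:X^\ell\to\{0,1\}$ and $c_a(x)=1$ if and only if $x_i\le a_i$ for all $1\le i\le \ell$. A randomized algorithm $A$ taking databases of $n$ labeled examples from $X^\ell\times\{0,1\}$ is - $(\varepsilon,\delta)$-differentially private if $\Pr[A(S)\in T]\le e^{\varepsilon}\Pr[A(S')\in T]+\delta$ for all $S,S'$ that differ in one row and all sets $T$ of outputs; - an $(\alpha,\beta)$-accurate proper learner for $\mathrm{THRESH}_X^{\ell}$ if it always outputs a hypothesis in $\mathrm{THRESH}_X^{\ell}$ and, for every $c\in\mathrm{THRESH}_X^{\ell}$ and every distribution $\mathcal D$ on $X^\ell$, when run on $n$ i.i.d. samples from $\mathcal D$ labeled by $c$, it outputs with probability at least $1-\beta$ (over the samples and its coins) some $h$ with $\Pr_{x\sim\mathcal D}[h(x)\ne c(x)]\le\alpha$. Theorem. 1. There is an absolute constant $\lambda>0$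 such that for every finite nonempty totally ordered $X$, all $n,\ell\in\mathbb N$, all $0<\alpha\le 1/8$ and all $\delta$ with $1500\,n^2\,\delta\le \ell^2$ (that is, $\delta\le \ell^2/(1500n^2)$ when $n>0$), every $(\tfrac12,\delta)$-differentially private and $(\alpha,\tfrac18)$-accurate proper learner for $\mathrm{THRESH}_X^{\ell}$ with sample size $n$ satisfies $$n\ \ge\ \lambda\cdot\frac{\ell}{\alpha}\cdot\log^*|X| .$$ 2. This separates private proper learning from non-private proper learning for every VC dimension: if $|X|\ge 2$, the VC dimension of $\mathrm{THRESH}_X^{\ell}$ is exactly $\ell$; and for all $\alpha,\beta>0$ there is a constant $K=K(\alpha,\beta)$ such that for every finite nonempty totally ordered $X$ and every $\ell$ there is a (not necessarily private) $(\alpha,\beta)$-accurate proper learner for $\mathrm{THRESH}_X^{\ell}$ with sample size at most $K\ell$. -/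

import Mathlib

/-- `tower 0 = 1`, `tower (k + 1) = 2 ^ tower k`. -/
def tower : ℕ → ℕ
  | 0 => 1
  | k + 1 => 2 ^ tower k

theorem lt_tower (k : ℕ) : k < tower k := by
  induction k with
  | zero => simp [tower]
  | succ k ih => exact lt_of_le_of_lt ih Nat.lt_two_pow_self

/-- The iterated logarithm (base 2): the number of times `log₂` has to be applied to `N`
until the result is at most `1`, i.e. the least `k` with `N ≤ tower k`. -/
noncomputable def logStar (N : ℕ) : ℕ := sInf {k : ℕ | N ≤ tower k}

theorem logStar_le_iff (N k : ℕ) : logStar N ≤ k ↔ N ≤ tower k := by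
  have hmono : Monotone tower := monotone_nat_of_le_succ fun j => Nat.lt_two_pow_self.le
  have hne : {k : ℕ | N ≤ tower k}.Nonempty := ⟨N, (lt_tower N).le⟩
  exact ⟨fun h => (Nat.sInf_mem hne).trans (hmono h), fun h => Nat.sInf_le h⟩

/-- The probability of an event under a (discrete) distribution. -/
noncomputable def prob {Y : Type*} (p : PMF Y) (E : Set Y) : ℝ := (p.toOuterMeasure E).toReal

/-- `n` independent samples from `D`. -/
noncomputable def iidSample {Z : Type*} (D : PMF Z) : (n : ℕ) → PMF (Fin n → Z)
  | 0 => PMF.pure Fin.elim0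
  | n + 1 => D.bind fun z => (iidSample D n).map fun zs => Fin.cons z zs

/-- A randomized algorithm on databases with `n` rows is `(ε, δ)`-differentially private. -/
def IsDP {R Y : Type*} {n : ℕ} (ε δ : ℝ) (M : (Fin n → R) → PMF Y) : Prop :=
  ∀ D D' : Fin n → R, (∃ i, ∀ j, j ≠ i → D j = D' j) →
    ∀ T : Set Y, prob (M D) T ≤ Real.exp ε * prob (M D') T + δ

/-- The generalization error of the hypothesis `h` for the target concept `c` under `D`. -/
noncomputable def genError {Z : Type*} (D : PMF Z) (c h : Z → Bool) : ℝ :=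
  prob D {z | h z ≠ c z}

/-- `A` is an `(α, β)`-accurate PAC learner for the concept class `C` using the hypothesis class
`H`, with sample complexity `n`. -/
structure IsPACLearner {Z : Type*} {n : ℕ} (C H : Set (Z → Bool)) (α β : ℝ)
    (A : (Fin n → Z × Bool) → PMF (Z → Bool)) : Prop where
  output_mem : ∀ S : Fin n → Z × Bool, (A S).support ⊆ H
  accurate : ∀ c ∈ C, ∀ D : PMF Z,
    1 - β ≤ prob ((iidSample D n).bind fun zs => A fun i => (zs i, c (zs i)))
      {h | genError D c h ≤ α}

/-- A proper PAC learner: its hypothesis class is contained in the concept class. -/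
def IsProperPACLearner {Z : Type*} {n : ℕ} (C : Set (Z → Bool)) (α β : ℝ)
    (A : (Fin n → Z × Bool) → PMF (Z → Bool)) : Prop :=
  ∃ H ⊆ C, IsPACLearner C H α β A

/-- The concept `c_a` on `X^ℓ`: `c_a(x) = 1` iff `x_i ≤ a_i` for every `i`. -/
def threshConcept {X : Type*} [LinearOrder X] {ℓ : ℕ} (a : Fin ℓ → X) : (Fin ℓ → X) → Bool :=
  fun x => decide (∀ i, x i ≤ a i)

/-- The class `THRESH_X^ℓ` of `ℓ`-dimensional thresholds. -/
def thresh (X : Type*) [LinearOrder X] (ℓ : ℕ) : Set ((Fin ℓ → X) → Bool) :=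
  Set.range threshConcept

/-- The concept class `C` shatters `S`: all labelings of `S` come from `C`. -/
def ShattersSet {Z : Type*} (C : Set (Z → Bool)) (S : Finset Z) : Prop :=
  ∀ T ⊆ S, ∃ c ∈ C, ∀ z ∈ S, (c z = true ↔ z ∈ T)

/-- `d` is the VC dimension of `C`: the largest cardinality of a shattered set. -/
def IsVCDim {Z : Type*} (C : Set (Z → Bool)) (d : ℕ) : Prop :=
  IsGreatest {k : ℕ | ∃ S : Finset Z, ShattersSet C S ∧ S.card = k} d

/-! The lower bound reduces learning to a multi-instance interior point problem: given `ℓ` databases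
of `m` numbers, privately output for each a value between its least and greatest entry, succeeding
on a constant fraction of them on average. For this problem there is a digit-hiding recursion
(`IsMultiSolver.step`). Draw a secret `y` with `N` base `b` digits; entries `x i < N` become `y`
with its last `x i + 1` digits erased, next to `y` itself. An interior point of these shares a long
prefix with `y`, and the place where agreement ends is an interior point of the `x i`, unless a
digit that is nearly invisible to the mechanism was guessed. So `m + 1` rows over `b ^ N` values
yield `m` rows over `N` values, at an additive loss `e / b + δ`. One row over two values is hopeless
beyond `(e + δ) / (1 + e)` (`IsMultiSolver.base`), so with few rows the domain size is bounded by a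
tower. A proper learner gives a solver (`exists_multiSolver_of_learner`): mass `8 α` is spread over
labeled points on the `ℓ` axes, so error `α` leaves most axes mostly correct. Each row has mass `8 α
/ (ℓ m)`, and subsampling makes the solver stable once `m` is of order `α n / ℓ`. Hence `log* |X|`
is at most a constant times `α n / ℓ`. Without privacy, the smallest box around the positive
examples works: a leave-one-out argument bounds its expected error by `ℓ / (n + 1)`, and Markov's
inequality finishes. -/

section ProbabilityTools

/-! ### Elementary facts on probabilities of events. -/

theorem prob_eq_tsum {Y : Type*} (p : PMF Y) (T : Set Y) :
    prob p T = (∑' y, T.indicator p y).toReal := by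
  rw [prob, PMF.toOuterMeasure_apply]

theorem prob_nonneg {Y : Type*} (p : PMF Y) (T : Set Y) : 0 ≤ prob p T := ENNReal.toReal_nonneg

theorem toOuterMeasure_le_one {Y : Type*} (p : PMF Y) (T : Set Y) : p.toOuterMeasure T ≤ 1 := by
  rw [PMF.toOuterMeasure_apply, ← p.tsum_coe]
  exact ENNReal.tsum_le_tsum fun y => Set.indicator_le_self _ _ _

theorem toOuterMeasure_ne_top {Y : Type*} (p : PMF Y) (T : Set Y) : p.toOuterMeasure T ≠ ⊤ :=
  ((toOuterMeasure_le_one p T).trans_lt ENNReal.one_lt_top).ne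

theorem prob_le_one {Y : Type*} (p : PMF Y) (T : Set Y) : prob p T ≤ 1 :=
  ENNReal.toReal_le_of_le_ofReal zero_le_one (by simpa using toOuterMeasure_le_one p T)

theorem prob_mono {Y : Type*} (p : PMF Y) {S T : Set Y} (h : S ⊆ T) : prob p S ≤ prob p T :=
  ENNReal.toReal_mono (toOuterMeasure_ne_top p T) (p.toOuterMeasure.mono h)

theorem prob_mono_support {Y : Type*} (p : PMF Y) {S T : Set Y} (h : S ∩ p.support ⊆ T) :
    prob p S ≤ prob p T :=
  ENNReal.toReal_mono (toOuterMeasure_ne_top p T) (PMF.toOuterMeasure_mono p h)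

theorem prob_union_le {Y : Type*} (p : PMF Y) (S T : Set Y) :
    prob p (S ∪ T) ≤ prob p S + prob p T := by
  rw [prob, prob, prob, ← ENNReal.toReal_add (toOuterMeasure_ne_top p S) (toOuterMeasure_ne_top p T)]
  exact ENNReal.toReal_mono
    (ENNReal.add_ne_top.2 ⟨toOuterMeasure_ne_top p S, toOuterMeasure_ne_top p T⟩)
    (MeasureTheory.measure_union_le S T)

theorem prob_map {Y W : Type*} (p : PMF Y) (f : Y → W) (T : Set W) :
    prob (p.map f) T = prob p (f ⁻¹' T) := by
  rw [prob, prob, PMF.toOuterMeasure_map_apply]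

theorem prob_bind {I Y : Type*} [Fintype I] (p : PMF I) (f : I → PMF Y) (T : Set Y) :
    prob (p.bind f) T = ∑ i, (p i).toReal * prob (f i) T := by
  rw [prob, PMF.toOuterMeasure_bind_apply, tsum_fintype, ENNReal.toReal_sum]
  · simp [prob, ENNReal.toReal_mul]
  · intro i _
    exact ENNReal.mul_ne_top (p.apply_ne_top i) (toOuterMeasure_ne_top _ T)

theorem prob_uniform_bind {I Y : Type*} [Fintype I] [Nonempty I] (f : I → PMF Y) (T : Set Y) :
    prob ((PMF.uniformOfFintype I).bind f) T = (∑ i, prob (f i) T) / Fintype.card I := by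
  rw [prob_bind, Finset.sum_div]
  refine Finset.sum_congr rfl fun i _ => ?_
  rw [PMF.uniformOfFintype_apply, ENNReal.toReal_inv, ENNReal.toReal_natCast]
  ring

open Classical in
theorem prob_eq_sum {Y : Type*} [Fintype Y] (p : PMF Y) (T : Set Y) :
    prob p T = ∑ y, if y ∈ T then (p y).toReal else 0 := by
  rw [prob_eq_tsum, tsum_fintype, ENNReal.toReal_sum]
  · refine Finset.sum_congr rfl fun y _ => ?_
    by_cases h : y ∈ T <;> simp [h]
  · intro y _
    by_cases h : y ∈ T <;> simp [h, p.apply_ne_top]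

theorem sum_toReal_eq_one {Y : Type*} [Fintype Y] (p : PMF Y) : ∑ y, (p y).toReal = 1 := by
  rw [← ENNReal.toReal_sum fun y _ => p.apply_ne_top y, ← tsum_fintype (L := .unconditional Y),
    p.tsum_coe, ENNReal.toReal_one]

theorem sum_prob_fiber_le_one {I Y : Type*} [Fintype I] (p : PMF Y) (T : I → Set Y)
    (hT : Pairwise fun i j => Disjoint (T i) (T j)) : ∑ i, prob p (T i) ≤ 1 := by
  have h : ∑ i, p.toOuterMeasure (T i) ≤ 1 := by
    simp only [PMF.toOuterMeasure_apply]
    rw [← tsum_fintype (L := .unconditional I), ENNReal.tsum_comm, ← p.tsum_coe]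
    refine ENNReal.tsum_le_tsum fun y => ?_
    rw [tsum_fintype]
    by_cases hy : ∃ i, y ∈ T i
    · obtain ⟨i, hi⟩ := hy
      rw [Finset.sum_eq_single i]
      · exact Set.indicator_le_self _ _ _
      · intro j _ hj
        exact Set.indicator_of_notMem (fun hyj => Set.disjoint_left.1 (hT hj) hyj hi) _
      · simp
    · push Not at hy
      simp [hy]
  have := ENNReal.toReal_mono ENNReal.one_ne_top h
  rwa [ENNReal.toReal_sum fun i _ => toOuterMeasure_ne_top p _, ENNReal.toReal_one] at this

/-- If every outcome of `E` lies in at least `r` of the sets `G j`, then the probabilities of the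
`G j` add up to at least `r` times the probability of `E`. -/
theorem mul_prob_le_sum_prob {Y J : Type*} [Fintype Y] [Fintype J] (p : PMF Y) (E : Set Y)
    (G : J → Set Y) (r : ℝ)
    (h : ∀ y ∈ E, y ∈ p.support → r ≤ ({j | y ∈ G j} : Set J).ncard) :
    r * prob p E ≤ ∑ j, prob p (G j) := by
  classical
  simp only [prob_eq_sum]
  rw [Finset.sum_comm, Finset.mul_sum]
  refine Finset.sum_le_sum fun y _ => ?_
  have hc : ∑ j, (if y ∈ G j then (p y).toReal else 0) =
      ({j | y ∈ G j} : Set J).ncard * (p y).toReal := by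
    rw [← Finset.sum_filter, Finset.sum_const, nsmul_eq_mul, Set.ncard_eq_toFinset_card']
    congr 3
    ext j; simp
  rw [hc]
  by_cases hE : y ∈ E
  · by_cases hs : y ∈ p.support
    · simpa [hE] using mul_le_mul_of_nonneg_right (h y hE hs) ENNReal.toReal_nonneg
    · have : p y = 0 := by simpa [PMF.mem_support_iff] using hs
      simp [this]
  · simp only [hE, if_false, mul_zero]
    positivity

end ProbabilityTools

/-! ### Expectations over i.i.d. samples, and privacy amplification by subsampling. -/

section Sampling

/-- The expectation of `G` over `n` independent draws with weights `v`. -/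
noncomputable def iidExp {Ω : Type*} [Fintype Ω] (v : Ω → ℝ) {n : ℕ} (G : (Fin n → Ω) → ℝ) : ℝ :=
  ∑ s, (∏ i, v (s i)) * G s

theorem iidExp_zero {Ω : Type*} [Fintype Ω] (v : Ω → ℝ) (G : (Fin 0 → Ω) → ℝ) :
    iidExp v G = G Fin.elim0 := by
  simp [iidExp, Subsingleton.elim _ (Fin.elim0 : Fin 0 → Ω)]

theorem iidExp_succ {Ω : Type*} [Fintype Ω] (v : Ω → ℝ) {n : ℕ} (G : (Fin (n + 1) → Ω) → ℝ) :
    iidExp v G = ∑ ω, v ω * iidExp v fun s => G (Fin.cons ω s) := by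
  simp only [iidExp]
  rw [← (Fin.consEquiv fun _ => Ω).sum_comp, Fintype.sum_prod_type]
  refine Finset.sum_congr rfl fun ω _ => ?_
  rw [Finset.mul_sum]
  refine Finset.sum_congr rfl fun s _ => ?_
  simp [Fin.consEquiv, Fin.prod_univ_succ, mul_assoc]

theorem iidExp_mono {Ω : Type*} [Fintype Ω] {v : Ω → ℝ} (hv : ∀ ω, 0 ≤ v ω) {n : ℕ}
    {G H : (Fin n → Ω) → ℝ} (h : ∀ s, G s ≤ H s) : iidExp v G ≤ iidExp v H :=
  Finset.sum_le_sum fun s _ =>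
    mul_le_mul_of_nonneg_left (h s) (Finset.prod_nonneg fun _ _ => hv _)

theorem iidExp_const {Ω : Type*} [Fintype Ω] (v : Ω → ℝ) (n : ℕ) (a : ℝ) :
    iidExp v (fun _ : Fin n → Ω => a) = (∑ ω, v ω) ^ n * a := by
  rw [iidExp, ← Finset.sum_mul, Finset.sum_pow' , Fintype.piFinset_univ]

theorem iidExp_affine {Ω : Type*} [Fintype Ω] (v : Ω → ℝ) {n : ℕ} (hv : ∑ ω, v ω = 1)
    (G : (Fin n → Ω) → ℝ) (a b : ℝ) :
    iidExp v (fun s => a * G s + b) = a * iidExp v G + b := by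
  have := iidExp_const v n b
  rw [hv, one_pow, one_mul] at this
  conv_rhs => rw [← this]
  simp only [iidExp, Finset.mul_sum, ← Finset.sum_add_distrib]
  exact Finset.sum_congr rfl fun s _ => by ring

theorem iidExp_sum {Ω J : Type*} [Fintype Ω] (v : Ω → ℝ) {n : ℕ} (t : Finset J)
    (G : J → (Fin n → Ω) → ℝ) :
    iidExp v (fun s => ∑ j ∈ t, G j s) = ∑ j ∈ t, iidExp v (G j) := by
  simp only [iidExp, Finset.mul_sum]
  exact Finset.sum_comm

theorem iidExp_perm {Ω : Type*} [Fintype Ω] (v : Ω → ℝ) {n : ℕ} (G : (Fin n → Ω) → ℝ)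
    (σ : Equiv.Perm (Fin n)) : iidExp v (fun s => G (s ∘ σ)) = iidExp v G := by
  simp only [iidExp]
  rw [← (Equiv.arrowCongr σ (Equiv.refl Ω)).sum_comp]
  refine Finset.sum_congr rfl fun s _ => ?_
  congr 1
  · exact Equiv.prod_comp σ.symm fun i => v (s i)
  · congr 1
    ext i
    simp [Equiv.arrowCongr]

theorem prob_iidSample_bind {Ω Y : Type*} [Fintype Ω] (D : PMF Ω) {n : ℕ}
    (F : (Fin n → Ω) → PMF Y) (T : Set Y) :
    prob ((iidSample D n).bind F) T = iidExp (fun ω => (D ω).toReal) fun s => prob (F s) T := by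
  induction n with
  | zero => rw [iidExp_zero, iidSample, PMF.pure_bind]
  | succ n ih =>
    rw [iidExp_succ, iidSample, PMF.bind_bind, prob_bind]
    refine Finset.sum_congr rfl fun ω _ => ?_
    rw [PMF.bind_map, ih]
    rfl

theorem iidSample_map {Ω Z : Type*} (D : PMF Ω) (f : Ω → Z) (n : ℕ) :
    iidSample (D.map f) n = (iidSample D n).map fun s i => f (s i) := by
  induction n with
  | zero =>
    rw [iidSample, iidSample, PMF.pure_map]
    congr 1
    exact Subsingleton.elim _ _
  | succ n ih =>
    rw [iidSample, iidSample, PMF.bind_map, PMF.map_bind]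
    congr 1
    ext1 ω
    simp only [Function.comp_apply, ih, PMF.map_comp]
    congr 1
    ext s i
    refine Fin.cases ?_ (fun i => ?_) i <;> simp

/-- Discarding an event of mass `q` from the sampling distribution changes the expectation of a
statistic which is stable under the change of one sample by a controlled factor. -/
theorem iidExp_le_of_stable {Ω : Type*} [Fintype Ω] {v v₀ : Ω → ℝ} (hv : ∀ ω, 0 ≤ v ω)
    (hv₀ : ∀ ω, 0 ≤ v₀ ω) (hs₀ : ∑ ω, v₀ ω = 1) (hs : ∑ ω, v ω = 1) {q e δ : ℝ}
    (hle : ∀ ω, (1 - q) * v₀ ω ≤ v ω) (he : 1 ≤ e) (hq : 0 ≤ q) (hδ : 0 ≤ δ) {n : ℕ}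
    (G : (Fin n → Ω) → ℝ)
    (hG : ∀ s s' : Fin n → Ω, (∃ i, ∀ j, j ≠ i → s j = s' j) → G s ≤ e * G s' + δ) :
    iidExp v G ≤ (1 + q * (e - 1)) ^ n * iidExp v₀ G + n * q * (1 + q * (e - 1)) ^ n * δ := by
  have hK : 1 ≤ 1 + q * (e - 1) := by nlinarith
  set K := 1 + q * (e - 1) with hKdef
  induction n with
  | zero => simp [iidExp_zero]
  | succ n ih =>
    set H : Ω → ℝ := fun ω => iidExp v₀ fun s => G (Fin.cons ω s) with hH
    have h1 : ∀ ω, iidExp v (fun s => G (Fin.cons ω s)) ≤ K ^ n * H ω + n * q * K ^ n * δ := by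
      intro ω
      refine ih _ fun s s' ⟨i, hi⟩ => hG _ _ ⟨i.succ, fun j hj => ?_⟩
      refine Fin.cases (by simp) (fun j hj => ?_) j hj
      simpa using hi j fun h => hj (by rw [h])
    have h2 : ∀ ω ω', H ω ≤ e * H ω' + δ := by
      intro ω ω'
      rw [hH, ← iidExp_affine v₀ hs₀]
      refine iidExp_mono hv₀ fun s => hG _ _ ⟨0, fun j hj => ?_⟩
      obtain ⟨j, rfl⟩ := Fin.exists_succ_eq.2 hj
      simp
    have h3 : iidExp v₀ G = ∑ ω, v₀ ω * H ω := iidExp_succ v₀ G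
    have h4 : ∀ ω, H ω ≤ e * iidExp v₀ G + δ := by
      intro ω
      calc H ω = ∑ ω', v₀ ω' * H ω := by rw [← Finset.sum_mul, hs₀, one_mul]
        _ ≤ ∑ ω', v₀ ω' * (e * H ω' + δ) :=
          Finset.sum_le_sum fun ω' _ => mul_le_mul_of_nonneg_left (h2 ω ω') (hv₀ ω')
        _ = e * iidExp v₀ G + δ := by
          rw [h3, Finset.mul_sum, ← one_mul δ, ← hs₀, Finset.sum_mul, ← Finset.sum_add_distrib]
          exact Finset.sum_congr rfl fun ω' _ => by rw [← Finset.sum_mul, hs₀]; ring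
    -- Split `v` as `(1 - q) v₀` plus a remainder of mass `q`. On the remainder `h4` costs a factor
    -- `e`, so one draw costs `(1 - q) + q e = K`.
    have h5 : ∑ ω, v ω * H ω ≤ K * iidExp v₀ G + q * δ := by
      have h6 : ∑ ω, (v ω - (1 - q) * v₀ ω) * H ω ≤
          ∑ ω, (v ω - (1 - q) * v₀ ω) * (e * iidExp v₀ G + δ) :=
        Finset.sum_le_sum fun ω _ =>
          mul_le_mul_of_nonneg_left (h4 ω) (sub_nonneg.2 (hle ω))
      rw [← Finset.sum_mul, Finset.sum_sub_distrib, ← Finset.mul_sum, hs₀, hs] at h6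
      have h7 : ∑ ω, v ω * H ω =
          ∑ ω, (v ω - (1 - q) * v₀ ω) * H ω + (1 - q) * iidExp v₀ G := by
        rw [h3, Finset.mul_sum, ← Finset.sum_add_distrib]
        exact Finset.sum_congr rfl fun ω _ => by ring
      rw [h7, hKdef]
      linarith
    have hKn : 0 ≤ K ^ n := by positivity
    calc iidExp v G = ∑ ω, v ω * iidExp v fun s => G (Fin.cons ω s) := iidExp_succ v G
      _ ≤ ∑ ω, v ω * (K ^ n * H ω + n * q * K ^ n * δ) :=
        Finset.sum_le_sum fun ω _ => mul_le_mul_of_nonneg_left (h1 ω) (hv ω)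
      _ = K ^ n * (∑ ω, v ω * H ω) + n * q * K ^ n * δ := by
        simp only [mul_add, Finset.sum_add_distrib, ← Finset.sum_mul, hs, Finset.mul_sum, one_mul]
        congr 1
        exact Finset.sum_congr rfl fun ω _ => by ring
      _ ≤ K ^ n * (K * iidExp v₀ G + q * δ) + n * q * K ^ n * δ := by gcongr
      _ = K ^ (n + 1) * iidExp v₀ G + (n + 1) * q * K ^ n * δ := by ring
      _ ≤ K ^ (n + 1) * iidExp v₀ G + ((n + 1 : ℕ) : ℝ) * q * K ^ (n + 1) * δ := by
        push_cast
        have : K ^ n ≤ K ^ (n + 1) := pow_le_pow_right₀ hK n.le_succ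
        gcongr

theorem iidExp_weight_mono {Ω : Type*} [Fintype Ω] {u v : Ω → ℝ} (hu : ∀ ω, 0 ≤ u ω)
    (huv : ∀ ω, u ω ≤ v ω) {n : ℕ} {G : (Fin n → Ω) → ℝ} (hG : ∀ s, 0 ≤ G s) :
    iidExp u G ≤ iidExp v G :=
  Finset.sum_le_sum fun s _ => mul_le_mul_of_nonneg_right
    (Finset.prod_le_prod (fun _ _ => hu _) fun _ _ => huv _) (hG s)

theorem iidExp_smul {Ω : Type*} [Fintype Ω] (v : Ω → ℝ) (a : ℝ) {n : ℕ} (G : (Fin n → Ω) → ℝ) :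
    iidExp (fun ω => a * v ω) G = a ^ n * iidExp v G := by
  simp only [iidExp, Finset.mul_sum, Finset.prod_mul_distrib, Finset.prod_const,
    Finset.card_univ, Fintype.card_fin, mul_assoc]

theorem iidExp_congr_of_support {Ω : Type*} [Fintype Ω] {v : Ω → ℝ} {n : ℕ}
    {G H : (Fin n → Ω) → ℝ} (h : ∀ s, (∀ i, v (s i) ≠ 0) → G s = H s) :
    iidExp v G = iidExp v H := by
  refine Finset.sum_congr rfl fun s _ => ?_
  by_cases hs : ∀ i, v (s i) ≠ 0
  · rw [h s hs]
  · push Not at hs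
    obtain ⟨i, hi⟩ := hs
    rw [Finset.prod_eq_zero (Finset.mem_univ i) hi, zero_mul, zero_mul]

/-- The part of the weights `v` outside `B`. -/
noncomputable def offWeight {Ω : Type*} (v : Ω → ℝ) (B : Set Ω) : Ω → ℝ := Bᶜ.indicator v

/-- Subsampling: statistics which agree on samples avoiding a set `B` of mass `q`, and which are
stable under the change of one sample, have comparable expectations. -/
theorem iidExp_le_of_agree {Ω : Type*} [Fintype Ω] {v : Ω → ℝ} (hv : ∀ ω, 0 ≤ v ω)
    (hs : ∑ ω, v ω = 1) (B : Set Ω) {q e δ : ℝ} (hB : ∑ ω, B.indicator v ω = q) (hq1 : q < 1)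
    (he : 1 ≤ e) (hδ : 0 ≤ δ) {n : ℕ} (G G' : (Fin n → Ω) → ℝ) (hG' : ∀ s, 0 ≤ G' s)
    (hag : ∀ s, (∀ i, s i ∉ B) → G s = G' s)
    (hG : ∀ s s' : Fin n → Ω, (∃ i, ∀ j, j ≠ i → s j = s' j) → G s ≤ e * G s' + δ) :
    (1 - q) ^ n * iidExp v G ≤
      (1 + q * (e - 1)) ^ n * iidExp v G' + (1 - q) ^ n * (n * q * (1 + q * (e - 1)) ^ n * δ) := by
  have hq : 0 ≤ q := hB ▸ Finset.sum_nonneg fun ω _ => Set.indicator_nonneg (fun _ _ => hv _) ω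
  have hq' : 0 < 1 - q := by linarith
  have hsplit : ∀ ω, offWeight v B ω + B.indicator v ω = v ω := fun ω => by
    rw [offWeight, Set.indicator_compl_add_self_apply]
  have hsum : ∑ ω, offWeight v B ω = 1 - q := by
    rw [← hs, ← hB, eq_sub_iff_add_eq, ← Finset.sum_add_distrib]
    exact Finset.sum_congr rfl fun ω _ => hsplit ω
  have hoff : ∀ ω, 0 ≤ offWeight v B ω := fun ω => Set.indicator_nonneg (fun _ _ => hv _) ω
  -- `v` conditioned on avoiding `B`; under it `G` and `G'` have the same expectation.
  set v₀ : Ω → ℝ := fun ω => (1 - q)⁻¹ * offWeight v B ω with hv₀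
  have hm : ∀ ω, (1 - q) * v₀ ω = offWeight v B ω := fun ω => by
    rw [hv₀]; field_simp
  have hle : ∀ ω, offWeight v B ω ≤ v ω := fun ω => by
    have := hsplit ω
    have : 0 ≤ B.indicator v ω := Set.indicator_nonneg (fun _ _ => hv _) ω
    linarith
  have h1 := iidExp_le_of_stable (v₀ := v₀) (q := q) hv
    (fun ω => mul_nonneg (inv_nonneg.2 hq'.le) (hoff ω))
    (by rw [hv₀, ← Finset.mul_sum, hsum, inv_mul_cancel₀ hq'.ne']) hs
    (fun ω => (hm ω).trans_le (hle ω)) he hq hδ G hG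
  have h2 : iidExp v₀ G = iidExp v₀ G' := iidExp_congr_of_support fun s hsup => by
    refine hag s fun i hi => hsup i ?_
    simp [hv₀, offWeight, hi]
  have h3 : (1 - q) ^ n * iidExp v₀ G' ≤ iidExp v G' := by
    rw [← iidExp_smul]
    simp only [hm]
    exact iidExp_weight_mono hoff hle hG'
  have hK : 0 ≤ (1 + q * (e - 1)) ^ n := by
    have := mul_nonneg hq (sub_nonneg.2 he)
    positivity
  calc (1 - q) ^ n * iidExp v G
      ≤ (1 - q) ^ n * ((1 + q * (e - 1)) ^ n * iidExp v₀ G' +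
          n * q * (1 + q * (e - 1)) ^ n * δ) := by
        rw [← h2]; gcongr
    _ = (1 + q * (e - 1)) ^ n * ((1 - q) ^ n * iidExp v₀ G') +
          (1 - q) ^ n * (n * q * (1 + q * (e - 1)) ^ n * δ) := by ring
    _ ≤ _ := by gcongr

/-- The version without privacy: a sample meets `B` with probability at most `n q`, by Bernoulli's
inequality. -/
theorem iidExp_le_add_of_agree {Ω : Type*} [Fintype Ω] {v : Ω → ℝ} (hv : ∀ ω, 0 ≤ v ω)
    (hs : ∑ ω, v ω = 1) (B : Set Ω) {q : ℝ} (hB : ∑ ω, B.indicator v ω = q) (hq1 : q ≤ 1) {n : ℕ}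
    (G G' : (Fin n → Ω) → ℝ) (hG' : ∀ s, 0 ≤ G' s) (hG1 : ∀ s, G s ≤ 1)
    (hag : ∀ s, (∀ i, s i ∉ B) → G s = G' s) :
    iidExp v G ≤ iidExp v G' + n * q := by
  have hsplit : ∀ ω, offWeight v B ω + B.indicator v ω = v ω := fun ω => by
    rw [offWeight, Set.indicator_compl_add_self_apply]
  have hsum : ∑ ω, offWeight v B ω = 1 - q := by
    rw [← hs, ← hB, eq_sub_iff_add_eq, ← Finset.sum_add_distrib]
    exact Finset.sum_congr rfl fun ω _ => hsplit ω
  have hoff : ∀ ω, 0 ≤ offWeight v B ω := fun ω => Set.indicator_nonneg (fun _ _ => hv _) ω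
  have hle : ∀ ω, offWeight v B ω ≤ v ω := fun ω => by
    have := hsplit ω
    have : 0 ≤ B.indicator v ω := Set.indicator_nonneg (fun _ _ => hv _) ω
    linarith
  have h1 := iidExp_weight_mono hoff hle (G := fun s => 1 - G s) fun s => by linarith [hG1 s]
  have h2 := iidExp_weight_mono hoff hle hG'
  have h3 : iidExp (offWeight v B) G = iidExp (offWeight v B) G' :=
    iidExp_congr_of_support fun s hsup => by
      refine hag s fun i hi => hsup i ?_
      simp [offWeight, hi]
  have h4 : ∀ w : Ω → ℝ, iidExp w (fun s => 1 - G s) = (∑ ω, w ω) ^ n - iidExp w G := by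
    intro w
    have := iidExp_const w n 1
    rw [mul_one] at this
    rw [← this]
    simp only [iidExp, mul_sub, Finset.sum_sub_distrib]
  rw [h4, h4, hs, hsum, one_pow] at h1
  have h5 : 1 + (n : ℝ) * (-q) ≤ (1 + -q) ^ n := one_add_mul_le_pow (by linarith) n
  rw [← sub_eq_add_neg] at h5
  linarith

end Sampling

/-! ### Base `b` digits and the guessing of a hidden digit. -/

section Digits

/-- The number with the base `b` digits `g`, the least significant one first. -/
def digitVal {b N : ℕ} (g : Fin N → Fin b) : ℕ := finFunctionFinEquiv g

theorem digitVal_lt {b N : ℕ} (g : Fin N → Fin b) : digitVal g < b ^ N :=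
  (finFunctionFinEquiv g).isLt

theorem digitVal_digit {b N : ℕ} (g : Fin N → Fin b) (k : Fin N) :
    digitVal g / b ^ (k : ℕ) % b = g k := by
  have h := congrFun (finFunctionFinEquiv.symm_apply_apply g) k
  exact congrArg Fin.val h

theorem digitVal_div_congr {b N : ℕ} {g g' : Fin N → Fin b} {t : ℕ}
    (h : ∀ i : Fin N, t ≤ i → g i = g' i) : digitVal g / b ^ t = digitVal g' / b ^ t := by
  rcases Nat.eq_zero_or_pos b with rfl | hb
  · rcases Nat.eq_zero_or_pos N with rfl | hN
    · rw [Subsingleton.elim g g']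
    · exact (g ⟨0, hN⟩).elim0
  have hlt : ∀ g : Fin N → Fin b, digitVal g / b ^ t < b ^ N := fun g =>
    (Nat.div_le_self _ _).trans_lt (digitVal_lt g)
  have key : (⟨_, hlt g⟩ : Fin (b ^ N)) = ⟨_, hlt g'⟩ := by
    apply finFunctionFinEquiv.symm.injective
    ext i
    simp only [finFunctionFinEquiv_symm_apply_val, Nat.div_div_eq_div_mul, ← pow_add]
    by_cases hi : t + i < N
    · have h1 := digitVal_digit g ⟨t + i, hi⟩
      have h2 := digitVal_digit g' ⟨t + i, hi⟩
      simp only at h1 h2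
      rw [h1, h2, h _ (by simp)]
    · have hpow : b ^ N ≤ b ^ (t + i) := Nat.pow_le_pow_right hb (by omega)
      rw [Nat.div_eq_of_lt ((digitVal_lt g).trans_le hpow),
        Nat.div_eq_of_lt ((digitVal_lt g').trans_le hpow)]
  exact congrArg Fin.val key

/-- The least `t` such that `a` and `y` agree up to the last `t + 1` base `b` digits. -/
noncomputable def suffixLen (b y a : ℕ) : ℕ := sInf {t | a / b ^ (t + 1) = y / b ^ (t + 1)}

theorem suffixLen_le {b y a t : ℕ} (h : a / b ^ (t + 1) = y / b ^ (t + 1)) :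
    suffixLen b y a ≤ t := Nat.sInf_le h

/-- The witness `s` excludes the default value `0` of `sInf` on the empty set, which occurs for `b =
1`. -/
theorem div_eq_of_suffixLen_lt {b y a t s : ℕ} (hs : a / b ^ (s + 1) = y / b ^ (s + 1))
    (h : suffixLen b y a < t) : a / b ^ t = y / b ^ t := by
  have hm : a / b ^ (suffixLen b y a + 1) = y / b ^ (suffixLen b y a + 1) :=
    Nat.sInf_mem (s := {t | a / b ^ (t + 1) = y / b ^ (t + 1)}) ⟨s, hs⟩
  obtain ⟨c, hc⟩ := Nat.exists_eq_add_of_lt h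
  have : t = suffixLen b y a + 1 + c := by omega
  rw [this, pow_add _ (suffixLen b y a + 1), ← Nat.div_div_eq_div_mul, ← Nat.div_div_eq_div_mul, hm]

/-- Resampling one coordinate preserves the uniform distribution: swapping the old and the new value
is an involution on pairs. -/
theorem sum_sum_update {P β : Type*} [Fintype P] [DecidableEq P] [Fintype β] (p : P)
    (f : (P → β) → ℝ) :
    ∑ g : P → β, ∑ d : β, f (Function.update g p d) = Fintype.card β * ∑ g, f g := by
  have hinv : Function.Involutive fun x : (P → β) × β => (Function.update x.1 p x.2, x.1 p) := by
    rintro ⟨g, d⟩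
    simp
  rw [← Fintype.sum_prod_type' fun g d => f (Function.update g p d),
    ← Equiv.sum_comp hinv.toPerm]
  simp [Fintype.sum_prod_type, Finset.mul_sum]

/-- A mechanism cannot guess a random digit which it hardly sees. -/
theorem sum_prob_guess_le {ℓ N b : ℕ} {Y : Type*} (j : Fin ℓ) (k : Fin N) (a : Y → ℕ)
    (F F' : (Fin ℓ × Fin N → Fin b) → PMF Y) {e δ : ℝ} (he : 0 ≤ e)
    (hinv : ∀ g d, F' (Function.update g (j, k) d) = F' g)
    (hF : ∀ g T, prob (F g) T ≤ e * prob (F' g) T + δ) :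
    ∑ g, prob (F g) {h | a h / b ^ (k : ℕ) = digitVal (fun i => g (j, i)) / b ^ (k : ℕ)} ≤
      (e / b + δ) * Fintype.card (Fin ℓ × Fin N → Fin b) := by
  rcases Nat.eq_zero_or_pos b with rfl | hb
  · have : IsEmpty (Fin ℓ × Fin N → Fin 0) := ⟨fun g => (g (j, k)).elim0⟩
    simp
  set T : (Fin ℓ × Fin N → Fin b) → Set Y :=
    fun g => {h | a h / b ^ (k : ℕ) = digitVal (fun i => g (j, i)) / b ^ (k : ℕ)} with hT
  have hb' : (0 : ℝ) < b := by exact_mod_cast hb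
  -- With the other digits fixed, the events for the `b` values of digit `k` are disjoint, as each
  -- forces digit `k` of `a h`. `F'` does not see this digit, so it hits with average probability at
  -- most `1 / b`.
  have h1 : ∀ g, ∑ d, prob (F' g) (T (Function.update g (j, k) d)) ≤ 1 := by
    intro g
    have hmem : ∀ d, ∀ h ∈ T (Function.update g (j, k) d), a h / b ^ (k : ℕ) % b = d := by
      intro d h hh
      rw [hT, Set.mem_ofPred_eq] at hh
      rw [hh, digitVal_digit]
      simp
    refine sum_prob_fiber_le_one (F' g) _ fun d d' hd => Set.disjoint_left.2 fun h hh hh' => ?_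
    exact hd (Fin.ext ((hmem d h hh).symm.trans (hmem d' h hh')))
  have h2 : b * ∑ g, prob (F' g) (T g) ≤ Fintype.card (Fin ℓ × Fin N → Fin b) := by
    have h3 := sum_sum_update (j, k) fun g => prob (F' g) (T g)
    simp only [hinv, Fintype.card_fin] at h3
    rw [← h3]
    refine (Finset.sum_le_sum fun g _ => h1 g).trans ?_
    simp
  calc ∑ g, prob (F g) (T g) ≤ ∑ g, (e * prob (F' g) (T g) + δ) :=
        Finset.sum_le_sum fun g _ => hF g _
    _ = e * (∑ g, prob (F' g) (T g)) + δ * Fintype.card (Fin ℓ × Fin N → Fin b) := by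
        rw [Finset.sum_add_distrib, Finset.mul_sum, Finset.sum_const, Finset.card_univ,
          nsmul_eq_mul, mul_comm δ]
    _ ≤ e * (Fintype.card (Fin ℓ × Fin N → Fin b) / b) +
          δ * Fintype.card (Fin ℓ × Fin N → Fin b) := by
        gcongr
        rw [le_div_iff₀ hb', mul_comm]
        exact h2
    _ = _ := by ring

end Digits

/-! ### The recursion for the multi-instance interior point problem. -/

section InteriorPoint

/-- `M` is a stable mechanism which, given `ℓ` databases with `m` entries below `N` each, finds
interior points of an expected fraction of at least `p` of them. -/
structure IsMultiSolver (ℓ m N : ℕ) (e δ p : ℝ)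
    (M : (Fin ℓ → Fin m → ℕ) → PMF (Fin ℓ → ℕ)) : Prop where
  stable : ∀ x x' : Fin ℓ → Fin m → ℕ,
    (∃ j i, ∀ j' i', (j' ≠ j ∨ i' ≠ i) → x j' i' = x' j' i') →
      ∀ T, prob (M x) T ≤ e * prob (M x') T + δ
  success : ∀ x : Fin ℓ → Fin m → ℕ, (∀ j i, x j i < N) →
    p * ℓ ≤ ∑ j, prob (M x) {a | (∃ i, x j i ≤ a j) ∧ ∃ i, a j ≤ x j i}

/-- Draw random digits `g`, run `F g`, and report up to which digit each output agrees with `g`. -/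
noncomputable def decodeMech {ℓ N b : ℕ} [NeZero b]
    (F : (Fin ℓ × Fin N → Fin b) → PMF (Fin ℓ → ℕ)) : PMF (Fin ℓ → ℕ) :=
  (PMF.uniformOfFintype (Fin ℓ × Fin N → Fin b)).bind fun g =>
    (F g).map fun a j => suffixLen b (digitVal fun i => g (j, i)) (a j)

theorem prob_decodeMech {ℓ N b : ℕ} [NeZero b] (F : (Fin ℓ × Fin N → Fin b) → PMF (Fin ℓ → ℕ))
    (T : Set (Fin ℓ → ℕ)) : prob (decodeMech F) T =
      (∑ g, prob (F g) {a | (fun j => suffixLen b (digitVal fun i => g (j, i)) (a j)) ∈ T}) /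
        Fintype.card (Fin ℓ × Fin N → Fin b) := by
  rw [decodeMech, prob_uniform_bind]
  simp only [prob_map]
  rfl

theorem decodeMech_stable {ℓ N b : ℕ} [NeZero b]
    (F F' : (Fin ℓ × Fin N → Fin b) → PMF (Fin ℓ → ℕ)) {e δ : ℝ}
    (h : ∀ g T, prob (F g) T ≤ e * prob (F' g) T + δ) (T : Set (Fin ℓ → ℕ)) :
    prob (decodeMech F) T ≤ e * prob (decodeMech F') T + δ := by
  rw [prob_decodeMech, prob_decodeMech]
  have hc : (0 : ℝ) < Fintype.card (Fin ℓ × Fin N → Fin b) := by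
    exact_mod_cast Fintype.card_pos
  rw [div_le_iff₀ hc, add_mul, mul_assoc, div_mul_cancel₀ _ hc.ne', Finset.mul_sum]
  refine (Finset.sum_le_sum fun g _ => h g _).trans_eq ?_
  rw [Finset.sum_add_distrib, Finset.sum_const, Finset.card_univ, nsmul_eq_mul, mul_comm δ]

/-- Agreement with the secret above digit `x j i` puts the decoded value at or below `x j i`. It can
fall below the minimum of `x j` only if the output also agrees at the digit whose index is that
minimum; `hguess` makes this a guess of probability at most `e / b + δ`. -/
theorem decodeMech_success {ℓ m N b : ℕ} [NeZero b] [NeZero m] {x : Fin ℓ → Fin m → ℕ}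
    (hx : ∀ j i, x j i < N) (F : (Fin ℓ × Fin N → Fin b) → PMF (Fin ℓ → ℕ)) {e δ p : ℝ}
    (he : 0 ≤ e)
    (hp : ∀ g, p * ℓ ≤ ∑ j, prob (F g) {a | ∃ i, a j / b ^ (x j i + 1) =
      digitVal (fun i => g (j, i)) / b ^ (x j i + 1)})
    (hguess : ∀ (j : Fin ℓ) (k : Fin N), (∀ i, (k : ℕ) ≤ x j i) →
      ∃ F' : (Fin ℓ × Fin N → Fin b) → PMF (Fin ℓ → ℕ),
        (∀ g d, F' (Function.update g (j, k) d) = F' g) ∧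
        ∀ g T, prob (F g) T ≤ e * prob (F' g) T + δ) :
    (p - (e / b + δ)) * ℓ ≤
      ∑ j, prob (decodeMech F) {a | (∃ i, x j i ≤ a j) ∧ ∃ i, a j ≤ x j i} := by
  have hc : (0 : ℝ) < Fintype.card (Fin ℓ × Fin N → Fin b) := by
    exact_mod_cast Fintype.card_pos
  have hmin : ∀ j, ∃ i₀, ∀ i, x j i₀ ≤ x j i := fun j => Finite.exists_min (x j)
  choose i₀ hi₀ using hmin
  have hj : ∀ j, (∑ g, prob (F g) {a | ∃ i, a j / b ^ (x j i + 1) =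
      digitVal (fun i => g (j, i)) / b ^ (x j i + 1)}) / Fintype.card (Fin ℓ × Fin N → Fin b) -
        (e / b + δ) ≤
      prob (decodeMech F) {a | (∃ i, x j i ≤ a j) ∧ ∃ i, a j ≤ x j i} := by
    intro j
    obtain ⟨F', hinv, hF'⟩ := hguess j ⟨x j (i₀ j), hx _ _⟩ (hi₀ j)
    have hg := sum_prob_guess_le j ⟨x j (i₀ j), hx _ _⟩ (fun a : Fin ℓ → ℕ => a j) F F' he hinv hF'
    rw [prob_decodeMech, sub_le_iff_le_add, div_le_iff₀ hc, add_mul, div_mul_cancel₀ _ hc.ne']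
    refine le_trans ?_ (add_le_add_right hg _)
    rw [← Finset.sum_add_distrib]
    refine Finset.sum_le_sum fun g _ => ?_
    refine (prob_mono _ ?_).trans (prob_union_le _ _ _)
    rintro a ⟨i, hi⟩
    by_cases hbad : a j / b ^ x j (i₀ j) = digitVal (fun i => g (j, i)) / b ^ x j (i₀ j)
    · exact Or.inr hbad
    · refine Or.inl ⟨⟨i₀ j, ?_⟩, ⟨i, suffixLen_le hi⟩⟩
      by_contra hlt
      exact hbad (div_eq_of_suffixLen_lt hi (not_le.1 hlt))
  refine le_trans ?_ (Finset.sum_le_sum fun j _ => hj j)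
  rw [Finset.sum_sub_distrib, ← Finset.sum_div, Finset.sum_comm, Finset.sum_const,
    Finset.card_univ, Fintype.card_fin, nsmul_eq_mul, sub_mul, mul_comm (ℓ : ℝ)]
  gcongr
  rw [le_div_iff₀ hc]
  refine le_trans (le_of_eq ?_) (Finset.sum_le_sum fun g _ => hp g)
  rw [Finset.sum_const, Finset.card_univ, nsmul_eq_mul, mul_comm]

/-- The databases with one more entry: the number with the digits `g`, and its truncations. -/
def extendRows {ℓ m N : ℕ} (b : ℕ) (x : Fin ℓ → Fin m → ℕ) (g : Fin ℓ × Fin N → Fin b) :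
    Fin ℓ → Fin (m + 1) → ℕ := fun j =>
  Fin.cons (digitVal fun i => g (j, i))
    fun i => digitVal (fun i => g (j, i)) / b ^ (x j i + 1) * b ^ (x j i + 1)

theorem div_eq_div_of_interior {b y a : ℕ} (hb : 0 < b) {l u s : ℕ}
    (hl : y / b ^ s * b ^ s ≤ l) (hu : u ≤ y) (hla : l ≤ a) (hau : a ≤ u) :
    a / b ^ s = y / b ^ s := by
  have hpos : 0 < b ^ s := pow_pos hb s
  refine le_antisymm (Nat.div_le_div_right (hau.trans hu)) ?_
  rw [Nat.le_div_iff_mul_le hpos]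
  exact hl.trans hla

/-- Changing an entry of `x` changes one truncation, hence one row of the larger database, so
stability is inherited. The loss is that of guessing a digit which only the untruncated row reveals.
-/
theorem IsMultiSolver.step {ℓ m N b : ℕ} [NeZero b] [NeZero m] {e δ p : ℝ} (he : 0 ≤ e)
    {M : (Fin ℓ → Fin (m + 1) → ℕ) → PMF (Fin ℓ → ℕ)}
    (hM : IsMultiSolver ℓ (m + 1) (b ^ N) e δ p M) :
    ∃ M', IsMultiSolver ℓ m N e δ (p - (e / b + δ)) M' := by
  have hb : 0 < b := NeZero.pos b
  refine ⟨fun x => decodeMech (N := N) fun g => M (extendRows b x g), ⟨?_, ?_⟩⟩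
  · rintro x x' ⟨j, i, h⟩ T
    refine decodeMech_stable _ _ (fun g T => hM.stable _ _ ⟨j, i.succ, fun j' i' h' => ?_⟩ T) T
    refine Fin.cases (fun _ => ?_) (fun i' h' => ?_) i' h'
    · simp [extendRows]
    · have := h j' i' (h'.imp_right fun hne he => hne (by rw [he]))
      simp [extendRows, this]
  · intro x hx
    have htrunc : ∀ y s : ℕ, y / b ^ s * b ^ s ≤ y := fun y s => Nat.div_mul_le_self y _
    refine decodeMech_success hx _ he (fun g => ?_) fun j k hk => ?_
    · refine (hM.success (extendRows b x g) fun j i => ?_).trans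
        (Finset.sum_le_sum fun j _ => prob_mono _ ?_)
      · refine Fin.cases ?_ (fun i => ?_) i
        · exact digitVal_lt _
        · exact (htrunc _ _).trans_lt (digitVal_lt _)
      · rintro a ⟨⟨i₁, h₁⟩, ⟨i₂, h₂⟩⟩
        have hup : extendRows b x g j i₂ ≤ digitVal fun i => g (j, i) := by
          refine Fin.cases ?_ (fun i => ?_) i₂
          · exact le_rfl
          · exact htrunc _ _
        revert h₁
        refine Fin.cases (fun h₁ => ?_) (fun i h₁ => ?_) i₁
        · exact ⟨0, div_eq_div_of_interior hb (htrunc _ _) hup h₁ h₂⟩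
        · exact ⟨i, div_eq_div_of_interior hb le_rfl hup h₁ h₂⟩
    -- Every truncation erases digit `k`, since `k ≤ x j i`. Zeroing it in the full row as well
    -- hides it completely and alters a single row.
    · refine ⟨fun g => M fun j' => Fin.cons
        (extendRows b x (Function.update g (j, k) ⟨0, hb⟩) j' 0)
        fun i => extendRows b x g j' i.succ, fun g d => ?_, fun g T => ?_⟩
      · refine congrArg M (funext fun j' => funext fun i => ?_)
        refine Fin.cases ?_ (fun i => ?_) i
        · simp [extendRows]
        · simp only [extendRows, Fin.cons_succ]
          rw [digitVal_div_congr fun i' hi' => ?_]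
          rw [Function.update_of_ne]
          intro heq
          obtain ⟨rfl, rfl⟩ := Prod.mk.inj heq
          have := hk i
          omega
      · refine hM.stable _ _ ⟨j, 0, fun j' i' h' => ?_⟩ T
        revert h'
        refine Fin.cases (fun h' => ?_) (fun i' _ => ?_) i'
        · have hj : j' ≠ j := h'.resolve_right fun h => h rfl
          simp only [extendRows, Fin.cons_zero]
          congr 1
          ext i
          rw [Function.update_of_ne]
          exact fun heq => hj (Prod.mk.inj heq).1
        · simp

/-- With one bit per instance an interior point is the bit itself. Flipping bit `j` gives `f g ≤ e
(1 - f (flip g)) + δ`; averaging over uniform bits bounds the success for each `j`. -/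
theorem IsMultiSolver.base {ℓ : ℕ} (hℓ : 0 < ℓ) {e δ p : ℝ} (he : 0 ≤ e)
    {M : (Fin ℓ → Fin 1 → ℕ) → PMF (Fin ℓ → ℕ)} (hM : IsMultiSolver ℓ 1 2 e δ p M) :
    p ≤ (e + δ) / (1 + e) := by
  set c : ℝ := ((Fintype.card (Fin ℓ → Fin 2) : ℕ) : ℝ) with hc
  have hcpos : 0 < c := by
    rw [hc]; exact_mod_cast Fintype.card_pos
  set f : Fin ℓ → (Fin ℓ → Fin 2) → ℝ :=
    fun j g => prob (M fun j _ => g j) {a | a j = (g j : ℕ)} with hf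
  have hflip : ∀ j : Fin ℓ, (1 + e) * ∑ g, f j g ≤ (e + δ) * c := by
    intro j
    have hinv : Function.Involutive fun g : Fin ℓ → Fin 2 => Function.update g j (1 - g j) := by
      intro g
      simp
    have h1 : ∀ g, f j g ≤ e * (1 - f j (Function.update g j (1 - g j))) + δ := by
      intro g
      refine (hM.stable _ (fun j' _ => (Function.update g j (1 - g j) j' : ℕ))
        ⟨j, 0, fun j' i' h => ?_⟩ _).trans ?_
      · rw [Function.update_of_ne]
        exact h.resolve_right fun h => h (Subsingleton.elim _ _)
      · gcongr
        have hdisj := sum_prob_fiber_le_one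
          (M fun j' _ => (Function.update g j (1 - g j) j' : ℕ))
          (fun d : Fin 2 => {a | a j = (d : ℕ)}) fun d d' hd => Set.disjoint_left.2
            fun a ha ha' => hd (Fin.ext (ha.symm.trans ha'))
        rw [Fin.sum_univ_two] at hdisj
        simp only [hf, Function.update_self]
        have h01 : g j = 0 ∨ g j = 1 := by omega
        rcases h01 with h01 | h01 <;> simp only [h01, sub_zero, sub_self] at hdisj ⊢ <;> linarith
    have h2 := Finset.sum_le_sum fun g (_ : g ∈ Finset.univ) => h1 g
    have h3 := Equiv.sum_comp hinv.toPerm (f j)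
    simp only [Function.Involutive.coe_toPerm] at h3
    rw [Finset.sum_add_distrib, ← Finset.mul_sum, Finset.sum_sub_distrib, h3, Finset.sum_const,
      Finset.sum_const, Finset.card_univ, nsmul_eq_mul, nsmul_eq_mul, mul_one, ← hc] at h2
    linarith
  have hsucc : p * ℓ * c ≤ ∑ j, ∑ g, f j g := by
    rw [Finset.sum_comm]
    refine le_trans (le_of_eq ?_) (Finset.sum_le_sum fun g _ =>
      hM.success (fun j _ => g j) fun j _ => (g j).isLt) |>.trans
        (Finset.sum_le_sum fun g _ => Finset.sum_le_sum fun j _ => prob_mono _ ?_)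
    · rw [Finset.sum_const, Finset.card_univ, nsmul_eq_mul, mul_comm]
    · rintro a ⟨⟨_, h₁⟩, ⟨_, h₂⟩⟩
      exact le_antisymm h₂ h₁
  have hall : (1 + e) * ∑ j, ∑ g, f j g ≤ ℓ * ((e + δ) * c) := by
    rw [Finset.mul_sum]
    refine (Finset.sum_le_sum fun j _ => hflip j).trans_eq ?_
    simp
  have hℓ' : (0 : ℝ) < ℓ := by exact_mod_cast hℓ
  rw [le_div_iff₀ (by linarith)]
  have h4 : (p * (1 + e)) * (ℓ * c) ≤ (e + δ) * (ℓ * c) := by nlinarith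
  exact le_of_mul_le_mul_right h4 (by positivity)

/-- The sizes of the domains for which `k + 1` rows do not suffice. -/
def hardSize : ℕ → ℕ
  | 0 => 2
  | k + 1 => (2 ^ (k + 6)) ^ hardSize k

/-- The bases double from level to level, so the guessing losses form the geometric sum `e (1/64 +
1/128 + ...)`, which stays below `e / 32` for any number of rows. -/
theorem IsMultiSolver.le {ℓ : ℕ} (hℓ : 0 < ℓ) {e δ : ℝ} (he : 0 ≤ e) (k : ℕ) {p : ℝ}
    {M : (Fin ℓ → Fin (k + 1) → ℕ) → PMF (Fin ℓ → ℕ)}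
    (hM : IsMultiSolver ℓ (k + 1) (hardSize k) e δ p M) :
    p ≤ (e + δ) / (1 + e) + k * δ + e * (1 / 32 - 1 / 2 ^ (k + 5)) := by
  induction k generalizing p with
  | zero =>
    refine (hM.base hℓ he).trans (le_of_eq ?_)
    norm_num
  | succ k ih =>
    have : NeZero (2 ^ (k + 6)) := ⟨by positivity⟩
    obtain ⟨M', hM'⟩ := IsMultiSolver.step he hM
    have h := ih hM'
    have h2 : (1 : ℝ) / 2 ^ (k + 5) = 2 * (1 / 2 ^ (k + 6)) := by
      rw [pow_succ _ (k + 5)]; field_simp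
    have h3 : e / ((2 ^ (k + 6) : ℕ) : ℝ) = e * (1 / 2 ^ (k + 6)) := by
      push_cast; ring
    rw [h3] at h
    rw [h2] at h
    have h4 : (k + 1 + 5) = k + 6 := by ring
    rw [h4]
    push_cast
    linarith

theorem mul_self_le_two_pow {n : ℕ} (hn : 4 ≤ n) : n * n ≤ 2 ^ n := by
  induction n, hn using Nat.le_induction with
  | base => norm_num
  | succ n hn ih => rw [pow_succ]; nlinarith

/-- Two exponentials per level suffice: one for the power, one to absorb the factor `k + 6`. -/
theorem hardSize_le_tower (k : ℕ) : hardSize k ≤ tower (2 * k + 6) := by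
  induction k with
  | zero => exact le_trans (by norm_num [hardSize]) (lt_tower _).le
  | succ k ih =>
    have hlt := lt_tower (2 * k + 6)
    calc hardSize (k + 1) = 2 ^ ((k + 6) * hardSize k) := by rw [hardSize, pow_mul]
      _ ≤ 2 ^ 2 ^ tower (2 * k + 6) := by
        refine Nat.pow_le_pow_right (by norm_num) ?_
        refine le_trans (Nat.mul_le_mul (by omega) ih) (mul_self_le_two_pow (by omega))
      _ = tower (2 * (k + 1) + 6) := rfl

end InteriorPoint

/-! ### From private proper learners to interior point solvers, and the lower bound. -/

section LearnerToSolver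

/-- Run `A` on `n` samples drawn from `v`, read through `Q`. -/
noncomputable def sampleMech {Ω R Y : Type*} {n : ℕ} (A : (Fin n → R) → PMF Y) (v : PMF Ω)
    (Q : Ω → R) : PMF Y :=
  (iidSample v n).bind fun s => A fun i => Q (s i)

theorem prob_sampleMech {Ω R Y : Type*} [Fintype Ω] {n : ℕ} (A : (Fin n → R) → PMF Y) (v : PMF Ω)
    (Q : Ω → R) (T : Set Y) : prob (sampleMech A v Q) T =
      iidExp (fun ω => (v ω).toReal) fun s => prob (A fun i => Q (s i)) T :=
  prob_iidSample_bind v _ T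

theorem exp_half_le : Real.exp (1 / 2) ≤ 33 / 20 := by
  have h : Real.exp (1 / 2) ^ 2 = Real.exp 1 := by
    rw [← Real.exp_nat_mul]; norm_num
  have h1 := Real.exp_one_lt_d9
  nlinarith [Real.exp_pos (1 / 2 : ℝ)]

theorem IsDP.nonneg {R Y : Type*} [Nonempty R] {n : ℕ} (hn : 0 < n) {ε δ : ℝ}
    {A : (Fin n → R) → PMF Y} (hA : IsDP ε δ A) : 0 ≤ δ := by
  obtain ⟨r⟩ := ‹Nonempty R›
  have h := hA (fun _ => r) (fun _ => r) ⟨⟨0, hn⟩, fun _ _ => rfl⟩ ∅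
  have h0 : ∀ p : PMF Y, prob p ∅ = 0 := fun p => by simp [prob]
  simpa [h0] using h

/-- Changing labeled points of total mass `q` is seen by about `n q` samples, which lowers the
privacy factor from `exp (1/2)` to `6 / 5`. The constants are `K ≤ 27/25`, `L ≥ 9/10` and `(27/25) /
(9/10) = 6/5`. -/
theorem sampleMech_stable {Ω R Y : Type*} [Fintype Ω] {n : ℕ} (hn : 0 < n) {δ : ℝ} (hδ : 0 ≤ δ)
    {A : (Fin n → R) → PMF Y} (hA : IsDP (1 / 2) δ A) (v : PMF Ω) (B : Set Ω) {q : ℝ}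
    (hB : ∑ ω, B.indicator (fun ω => (v ω).toReal) ω = q) (hq : n * q ≤ 1 / 10)
    {Q Q' : Ω → R} (hQ : ∀ ω ∉ B, Q ω = Q' ω) (T : Set Y) :
    prob (sampleMech A v Q) T ≤ 6 / 5 * prob (sampleMech A v Q') T + δ / 5 := by
  have hq0 : 0 ≤ q := hB ▸ Finset.sum_nonneg fun ω _ =>
    Set.indicator_nonneg (fun _ _ => ENNReal.toReal_nonneg) ω
  have hn1 : (1 : ℝ) ≤ n := by exact_mod_cast hn
  have hq1 : q ≤ 1 / 10 := by nlinarith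
  have he1 : 1 ≤ Real.exp (1 / 2) := Real.one_le_exp (by norm_num)
  have hmain := iidExp_le_of_agree (v := fun ω => (v ω).toReal) (fun _ => ENNReal.toReal_nonneg)
    (sum_toReal_eq_one v) B hB (by linarith) he1 hδ (n := n)
    (fun s => prob (A fun i => Q (s i)) T) (fun s => prob (A fun i => Q' (s i)) T)
    (fun s => prob_nonneg _ _)
    (fun s hs => by
      have : (fun i => Q (s i)) = fun i => Q' (s i) := funext fun i => hQ _ (hs i)
      simp only [this])
    (fun s s' ⟨i, hi⟩ => hA _ _ ⟨i, fun j hj => by simp only [hi j hj]⟩ T)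
  rw [← prob_sampleMech, ← prob_sampleMech] at hmain
  set P := prob (sampleMech A v Q) T
  set P' := prob (sampleMech A v Q') T
  have hP : 0 ≤ P := prob_nonneg _ _
  have hP' : 0 ≤ P' := prob_nonneg _ _
  set K := (1 + q * (Real.exp (1 / 2) - 1)) ^ n with hK
  have hK1 : K ≤ 27 / 25 := by
    have hbase : 1 + q * (Real.exp (1 / 2) - 1) ≤ Real.exp (q * (13 / 20)) := by
      have := Real.add_one_le_exp (q * (13 / 20))
      have := exp_half_le
      nlinarith
    have hb0 : 0 ≤ 1 + q * (Real.exp (1 / 2) - 1) := by nlinarith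
    have h1 : K ≤ Real.exp (13 / 200) := by
      refine (pow_le_pow_left₀ hb0 hbase n).trans ?_
      rw [← Real.exp_nat_mul]
      exact Real.exp_le_exp.2 (by nlinarith)
    have h2 := Real.add_one_le_exp (-(13 / 200) : ℝ)
    have h3 : Real.exp (13 / 200) * Real.exp (-(13 / 200)) = 1 := by
      rw [← Real.exp_add]; simp
    nlinarith [Real.exp_pos (13 / 200 : ℝ)]
  have hK0 : 0 ≤ K := by
    have : 0 ≤ q * (Real.exp (1 / 2) - 1) := mul_nonneg hq0 (by linarith)
    positivity
  set L := (1 - q) ^ n with hL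
  have hL1 : 9 / 10 ≤ L := by
    have h5 : 1 + (n : ℝ) * (-q) ≤ (1 + -q) ^ n := one_add_mul_le_pow (by linarith) n
    rw [← sub_eq_add_neg] at h5
    linarith
  have hnq : 0 ≤ n * q := by positivity
  have h6 : n * q * K * δ ≤ δ / 5 := by
    have : n * q * K ≤ 1 / 10 * (27 / 25) := by gcongr
    nlinarith
  have h7 : K * P' ≤ L * (6 / 5 * P') := by nlinarith
  have h8 : L * P ≤ L * (6 / 5 * P' + δ / 5) := by nlinarith
  exact le_of_mul_le_mul_left h8 (by linarith)

theorem sampleMech_le_add {Ω R Y : Type*} [Fintype Ω] {n : ℕ}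
    (A : (Fin n → R) → PMF Y) (v : PMF Ω) (B : Set Ω) {q : ℝ}
    (hB : ∑ ω, B.indicator (fun ω => (v ω).toReal) ω = q) (hq : q ≤ 1)
    {Q Q' : Ω → R} (hQ : ∀ ω ∉ B, Q ω = Q' ω) (T : Set Y) :
    prob (sampleMech A v Q) T ≤ prob (sampleMech A v Q') T + n * q := by
  rw [prob_sampleMech, prob_sampleMech]
  refine iidExp_le_add_of_agree (fun _ => ENNReal.toReal_nonneg) (sum_toReal_eq_one v) B hB hq
    _ _ (fun s => prob_nonneg _ _) (fun s => prob_le_one _ _) fun s hs => ?_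
  have : (fun i => Q (s i)) = fun i => Q' (s i) := funext fun i => hQ _ (hs i)
  simp only [this]

/-- The weights with mass `w` spread uniformly over `Ω`, and the rest on `none`. -/
noncomputable def nullWeight (Ω : Type*) [Fintype Ω] (w : ℝ) : Option Ω → ℝ
  | none => 1 - w
  | some _ => w / Fintype.card Ω

theorem exists_pmf_nullWeight (Ω : Type*) [Fintype Ω] [Nonempty Ω] {w : ℝ} (h0 : 0 ≤ w)
    (h1 : w ≤ 1) : ∃ v : PMF (Option Ω), ∀ o, (v o).toReal = nullWeight Ω w o := by
  have hnn : ∀ o, 0 ≤ nullWeight Ω w o := by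
    rintro (_ | o)
    · exact sub_nonneg.2 h1
    · exact div_nonneg h0 (Nat.cast_nonneg _)
  refine ⟨PMF.ofFintype (fun o => ENNReal.ofReal (nullWeight Ω w o)) ?_, fun o => ?_⟩
  · rw [← ENNReal.ofReal_sum_of_nonneg fun o _ => hnn o, Fintype.sum_option]
    have hc : (Fintype.card Ω : ℝ) ≠ 0 := by exact_mod_cast Fintype.card_ne_zero
    simp only [nullWeight, Finset.sum_const, Finset.card_univ, nsmul_eq_mul]
    rw [mul_div_cancel₀ _ hc]
    simp
  · rw [PMF.ofFintype_apply, ENNReal.toReal_ofReal (hnn o)]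

/-- The index of a labeled sample point: coordinate, row, and a point of the gadget of the row;
`none` is the null point. -/
abbrev SampleIdx (ℓ m : ℕ) (τ : Type) := Option (Fin ℓ × Fin m × τ)

theorem nullWeight_row {ℓ m : ℕ} {τ : Type} [Fintype τ] [Nonempty τ] (w : ℝ) (j : Fin ℓ)
    (i : Fin m) :
    ∑ ω, ({o | ∃ t, o = some (j, i, t)} : Set (SampleIdx ℓ m τ)).indicator
      (nullWeight (Fin ℓ × Fin m × τ) w) ω = w / (ℓ * m) := by
  classical
  have hc : (Fintype.card τ : ℝ) ≠ 0 := by exact_mod_cast Fintype.card_ne_zero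
  rw [Fintype.sum_option, Fintype.sum_prod_type, Finset.sum_eq_single j, Fintype.sum_prod_type,
    Finset.sum_eq_single i]
  · simp [Set.indicator, nullWeight]
    field_simp
  · intro i' _ hi
    simp [Set.indicator, hi]
  · simp
  · intro j' _ hj
    simp [Set.indicator, hj]
  · simp

theorem accurate_sampleMech {Ω Z : Type*} [Fintype Ω] {n : ℕ} {C H : Set (Z → Bool)} {α β : ℝ}
    {A : (Fin n → Z × Bool) → PMF (Z → Bool)} (hA : IsPACLearner C H α β A) {c : Z → Bool}
    (hc : c ∈ C) (v : PMF Ω) (Q : Ω → Z × Bool) (hQ : ∀ ω, c (Q ω).1 = (Q ω).2) :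
    1 - β ≤ prob (sampleMech A v Q) {h | prob v {ω | h (Q ω).1 ≠ (Q ω).2} ≤ α} := by
  have h := hA.accurate c hc (v.map fun ω => (Q ω).1)
  rw [iidSample_map, PMF.bind_map] at h
  have h1 : ((iidSample v n).bind
      ((fun zs => A fun i => (zs i, c (zs i))) ∘ fun s i => (Q (s i)).1)) = sampleMech A v Q := by
    rw [sampleMech]
    congr 1
    ext1 s
    simp only [Function.comp_apply, hQ]
  rw [h1] at h
  refine h.trans_eq ?_
  congr 1
  ext h
  simp only [genError, prob_map, Set.mem_ofPred_eq, Set.preimage_ofPred_eq, hQ]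

theorem support_sampleMech {Ω Z : Type*} {n : ℕ} {C H : Set (Z → Bool)} {α β : ℝ}
    {A : (Fin n → Z × Bool) → PMF (Z → Bool)} (hA : IsPACLearner C H α β A)
    (v : PMF Ω) (Q : Ω → Z × Bool) : (sampleMech A v Q).support ⊆ H := by
  intro h hh
  rw [sampleMech, PMF.mem_support_bind_iff] at hh
  obtain ⟨s, _, hs⟩ := hh
  exact hA.output_mem _ hs

/-- An accurate learner is accurate on most coordinates. -/
theorem sum_prob_coord_ge {ℓ m : ℕ} [NeZero ℓ] [NeZero m] {τ : Type} [Fintype τ] [Nonempty τ]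
    {Z : Type*} [Fintype Z] {n : ℕ} {C H : Set (Z → Bool)} {α : ℝ} (hα : 0 < α)
    {A : (Fin n → Z × Bool) → PMF (Z → Bool)} (hA : IsPACLearner C H α (1 / 8) A) {c : Z → Bool}
    (hc : c ∈ C) {v : PMF (SampleIdx ℓ m τ)}
    (hv : ∀ o, (v o).toReal = nullWeight (Fin ℓ × Fin m × τ) (8 * α) o)
    (Q : SampleIdx ℓ m τ → Z × Bool) (hQ : ∀ ω, c (Q ω).1 = (Q ω).2) {r : ℝ} (hr : 0 < r)
    (hr8 : 1 / 8 ≤ r) :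
    (1 - 1 / (8 * r)) * (7 / 8) * ℓ ≤ ∑ j, prob (sampleMech A v Q)
      {h | (({t | h (Q (some (j, t))).1 ≠ (Q (some (j, t))).2} : Set (Fin m × τ)).ncard : ℝ) <
        r * Fintype.card (Fin m × τ)} := by
  classical
  have hacc := accurate_sampleMech hA hc v Q hQ
  have hℓ : (0 : ℝ) < ℓ := by exact_mod_cast NeZero.pos ℓ
  have hpos : 0 ≤ (1 - 1 / (8 * r)) * ℓ := by
    refine mul_nonneg (sub_nonneg.2 ?_) hℓ.le
    rw [div_le_one (by positivity)]
    linarith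
  have hcard : (0 : ℝ) < Fintype.card (Fin m × τ) := by exact_mod_cast Fintype.card_pos
  refine le_trans ?_ (mul_prob_le_sum_prob (sampleMech A v Q)
    {h | prob v {ω | h (Q ω).1 ≠ (Q ω).2} ≤ α} _ ((1 - 1 / (8 * r)) * ℓ) fun h hh _ => ?_)
  · calc (1 - 1 / (8 * r)) * (7 / 8) * ℓ = (1 - 1 / (8 * r)) * ℓ * (1 - 1 / 8) := by ring
      _ ≤ _ := mul_le_mul_of_nonneg_left hacc hpos
  · set bad : Fin ℓ → Set (Fin m × τ) :=
      fun j => {t | h (Q (some (j, t))).1 ≠ (Q (some (j, t))).2} with hbad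
    set good : Set (Fin ℓ) := {j | ((bad j).ncard : ℝ) < r * Fintype.card (Fin m × τ)} with hgood
    have h1 : ∑ j, ((bad j).ncard : ℝ) * (8 * α / (ℓ * Fintype.card (Fin m × τ))) ≤ α := by
      refine le_trans ?_ hh
      rw [prob_eq_sum, Fintype.sum_option, Fintype.sum_prod_type]
      refine le_trans (Finset.sum_le_sum fun j _ => le_of_eq ?_)
        (le_add_of_nonneg_left (by split_ifs <;> simp))
      simp only [hv, nullWeight, Set.mem_ofPred_eq]
      rw [← Finset.sum_filter, Finset.sum_const, nsmul_eq_mul, Set.ncard_eq_toFinset_card',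
        Fintype.card_prod (Fin ℓ), Fintype.card_fin]
      push_cast
      congr 3
      ext t
      simp [hbad]
    have h2 : ∀ j, (if j ∈ good then 0 else 8 * α * r / ℓ) ≤
        ((bad j).ncard : ℝ) * (8 * α / (ℓ * Fintype.card (Fin m × τ))) := by
      intro j
      split_ifs with hj
      · positivity
      · have hj' : r * Fintype.card (Fin m × τ) ≤ (bad j).ncard := not_lt.1 hj
        calc 8 * α * r / ℓ = r * Fintype.card (Fin m × τ) *
              (8 * α / (ℓ * Fintype.card (Fin m × τ))) := by field_simp
          _ ≤ _ := by gcongr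
    have h3 : ∑ j, (if j ∈ good then (0 : ℝ) else 8 * α * r / ℓ) =
        (ℓ - good.ncard) * (8 * α * r / ℓ) := by
      have : ∀ j, (if j ∈ good then (0 : ℝ) else 8 * α * r / ℓ) =
          8 * α * r / ℓ - if j ∈ good then 8 * α * r / ℓ else 0 := fun j => by
        split_ifs <;> ring
      simp only [this]
      rw [Finset.sum_sub_distrib, ← Finset.sum_filter, Finset.sum_const, Finset.sum_const,
        Set.ncard_eq_toFinset_card', Finset.card_univ, Fintype.card_fin, nsmul_eq_mul,
        nsmul_eq_mul, sub_mul]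
      congr 4
      ext j
      simp
    have h4 : ((ℓ : ℝ) - good.ncard) * (8 * α * r / ℓ) ≤ α := by
      rw [← h3]
      exact (Finset.sum_le_sum fun j _ => h2 j).trans h1
    -- A bad coordinate carries error at least `8 α r / ℓ`, so total error `α` allows at most `ℓ /
    -- (8 r)` of them.
    have h5 : ((ℓ : ℝ) - good.ncard) ≤ ℓ / (8 * r) := by
      rw [le_div_iff₀ (by positivity)]
      have h6 : ((ℓ : ℝ) - good.ncard) * (8 * r) * (α / ℓ) ≤ ℓ * (α / ℓ) := by
        rw [mul_div_cancel₀ _ hℓ.ne']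
        refine le_trans (le_of_eq ?_) h4
        ring
      exact le_of_mul_le_mul_right h6 (by positivity)
    have h7 : (1 - 1 / (8 * r)) * ℓ = ℓ - ℓ / (8 * r) := by ring
    change (1 - 1 / (8 * r)) * (ℓ : ℝ) ≤ (good.ncard : ℝ)
    linarith

/-- `emb` lists the least `L + 1` elements and `pos` is the rank, so `emb 0` is the minimum of `X`:
axis points through it test one coordinate only. -/
theorem exists_embed (X : Type*) [LinearOrder X] [Fintype X] {L : ℕ}
    (h : L + 1 ≤ Fintype.card X) : ∃ (emb : ℕ → X) (pos : X → ℕ),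
      (∀ y ≤ L, ∀ a, emb y ≤ a ↔ y ≤ pos a) ∧ ∀ y ≤ L, pos (emb y) = y := by
  let e := Fintype.orderIsoFinOfCardEq X rfl
  refine ⟨fun y => e ⟨min y L, by omega⟩, fun a => e.symm a, fun y hy a => ?_, fun y hy => ?_⟩
  · rw [← e.le_symm_apply, Fin.le_def]
    simp [hy]
  · simp [hy]

/-- The point on the `j`-th axis through `z` with the coordinate `x`. -/
def axisPt {X : Type*} {ℓ : ℕ} (z : X) (j : Fin ℓ) (x : X) : Fin ℓ → X :=
  Function.update (fun _ => z) j x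

theorem threshConcept_axisPt {X : Type*} [LinearOrder X] {ℓ : ℕ} {z : X} (hz : ∀ a, z ≤ a)
    (a : Fin ℓ → X) (j : Fin ℓ) (x : X) :
    threshConcept a (axisPt z j x) = decide (x ≤ a j) := by
  rw [threshConcept, decide_eq_decide]
  refine ⟨fun h => by simpa [axisPt] using h j, fun h i => ?_⟩
  by_cases hij : i = j
  · subst hij; simpa [axisPt] using h
  · simpa [axisPt, hij] using hz _

/-- Without privacy, at least `ℓ / (16 α)` samples are needed. -/
theorem le_sixteen_mul_of_learner {X : Type*} [LinearOrder X] [Fintype X] {n ℓ : ℕ} (hℓ : 0 < ℓ)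
    (hX : 2 ≤ Fintype.card X) {α : ℝ} (hα : 0 < α) (hα8 : α ≤ 1 / 8)
    {A : (Fin n → (Fin ℓ → X) × Bool) → PMF ((Fin ℓ → X) → Bool)}
    {H : Set ((Fin ℓ → X) → Bool)} (hA : IsPACLearner (thresh X ℓ) H α (1 / 8) A) :
    (ℓ : ℝ) ≤ 16 * α * n := by
  have : NeZero ℓ := ⟨hℓ.ne'⟩
  have hℓ1 : (1 : ℝ) ≤ ℓ := by exact_mod_cast hℓ
  obtain ⟨emb, pos, hemb, hpos⟩ := exists_embed X hX
  have hz : ∀ a, emb 0 ≤ a := fun a => (hemb 0 (by norm_num) a).2 (Nat.zero_le _)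
  obtain ⟨v, hv⟩ := exists_pmf_nullWeight (Fin ℓ × Fin 1 × Unit) (w := 8 * α) (by linarith)
    (by linarith)
  let Q : (Fin ℓ → Fin 1 → ℕ) → SampleIdx ℓ 1 Unit → (Fin ℓ → X) × Bool := fun x o =>
    o.elim (fun _ => emb 0, true) fun t => (axisPt (emb 0) t.1 (emb 1), decide (1 ≤ x t.1 t.2.1))
  -- Each axis hides one bit as the label of one point. The factor is `1`, with an additive term
  -- bounding the chance that this point is sampled. For `r = 1` the success is `(7/8)(7/8) =
  -- 49/64`, and no error at all is allowed on a good axis.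
  have hsol : IsMultiSolver ℓ 1 2 1 (n * (8 * α / (ℓ * (1 : ℕ)))) (49 / 64) fun x =>
      (sampleMech A v (Q x)).map fun h j => if h (axisPt (emb 0) j (emb 1)) then 1 else 0 := by
    constructor
    · rintro x x' ⟨j, i, hx⟩ T
      rw [prob_map, prob_map, one_mul]
      refine sampleMech_le_add A v {o | ∃ t, o = some (j, i, t)} ?_ ?_ ?_ _
      · rw [← nullWeight_row (τ := Unit) (8 * α) j i]
        simp only [hv]
      · rw [div_le_one (by positivity)]
        push_cast
        linarith
      · rintro (_ | ⟨j', i', t⟩) ho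
        · rfl
        · have hne : j' ≠ j ∨ i' ≠ i := by
            by_contra hcon
            push Not at hcon
            exact ho ⟨t, by rw [hcon.1, hcon.2]⟩
          simp [Q, hx j' i' hne]
    · intro x hx
      have hc : ∀ ω, threshConcept (fun j => emb (x j 0)) (Q x ω).1 = (Q x ω).2 := by
        rintro (_ | ⟨j, i, t⟩)
        · exact decide_eq_true fun i => hz _
        · simp only [Q, Option.elim, threshConcept_axisPt hz, decide_eq_decide]
          rw [hemb 1 le_rfl, hpos _ (by have := hx j 0; omega), Subsingleton.elim i 0]
      have h := sum_prob_coord_ge hα hA ⟨_, rfl⟩ hv (Q x) hc (r := 1) one_pos (by norm_num)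
      refine le_trans (le_of_eq (by ring)) (h.trans (Finset.sum_le_sum fun j _ => ?_))
      rw [prob_map]
      refine prob_mono _ fun h hh => ?_
      rw [Set.mem_ofPred_eq, one_mul, Fintype.card_prod, Fintype.card_fin, Fintype.card_unit] at hh
      have h0 : ({t | h (Q x (some (j, t))).1 ≠ (Q x (some (j, t))).2} :
          Set (Fin 1 × Unit)).ncard = 0 := by
        have : ({t | h (Q x (some (j, t))).1 ≠ (Q x (some (j, t))).2} :
          Set (Fin 1 × Unit)).ncard < 1 := by exact_mod_cast hh
        omega
      rw [Set.ncard_eq_zero] at h0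
      have h1 : h (axisPt (emb 0) j (emb 1)) = decide (1 ≤ x j 0) := by
        by_contra hne
        exact Set.eq_empty_iff_forall_notMem.1 h0 (0, ()) hne
      have h2 := hx j 0
      have h3 : (if h (axisPt (emb 0) j (emb 1)) then 1 else 0) = x j 0 := by
        rw [h1]
        split_ifs with h4 <;> simp at h4 <;> omega
      exact ⟨⟨0, h3.ge⟩, ⟨0, h3.le⟩⟩
  have h := hsol.base hℓ zero_le_one
  have h1 : (n : ℝ) * (8 * α / (ℓ * (1 : ℕ))) = 8 * α * n / ℓ := by push_cast; ring
  rw [h1] at h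
  have h2 : 1 / 2 ≤ 8 * α * n / ℓ := by linarith
  rw [le_div_iff₀ (by linarith)] at h2
  linarith

/-- The threshold of a hypothesis. -/
noncomputable def thresholdOf {X : Type*} [LinearOrder X] [Nonempty X] {ℓ : ℕ}
    (h : (Fin ℓ → X) → Bool) : Fin ℓ → X := Classical.epsilon fun a => threshConcept a = h

theorem threshConcept_thresholdOf {X : Type*} [LinearOrder X] [Nonempty X] {ℓ : ℕ}
    {h : (Fin ℓ → X) → Bool} (hh : h ∈ thresh X ℓ) : threshConcept (thresholdOf h) = h :=
  Classical.epsilon_spec (p := fun a => threshConcept a = h) hh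

theorem div_pow_le_div_pow {b u w s t : ℕ} (hst : s ≤ t) (h : u / b ^ s ≤ w / b ^ s) :
    u / b ^ t ≤ w / b ^ t := by
  obtain ⟨c, rfl⟩ := Nat.exists_eq_add_of_le hst
  rw [pow_add, ← Nat.div_div_eq_div_mul, ← Nat.div_div_eq_div_mul]
  exact Nat.div_le_div_right h

/-- The windows around `y` are nested, so the larger of the two has `p` between both of its ends. -/
theorem exists_div_eq_of_window {m b y p : ℕ} (hb : 0 < b) {x : Fin m → ℕ}
    (h₁ : ∃ i, y / b ^ (x i + 1) * b ^ (x i + 1) ≤ p)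
    (h₂ : ∃ i, p < (y / b ^ (x i + 1) + 1) * b ^ (x i + 1)) :
    ∃ i, p / b ^ (x i + 1) = y / b ^ (x i + 1) := by
  obtain ⟨i, hi⟩ := h₁
  obtain ⟨k, hk⟩ := h₂
  rw [← Nat.le_div_iff_mul_le (pow_pos hb _)] at hi
  rw [← Nat.div_lt_iff_lt_mul (pow_pos hb _), Nat.lt_succ_iff] at hk
  rcases le_total (x i) (x k) with h | h
  · exact ⟨k, le_antisymm hk (div_pow_le_div_pow (by omega) hi)⟩
  · exact ⟨i, le_antisymm (div_pow_le_div_pow (by omega) hk) hi⟩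

/-- A private proper learner for thresholds gives a private solver for interior points. -/
theorem exists_multiSolver_of_learner {X : Type*} [LinearOrder X] [Fintype X] [Nonempty X]
    {n ℓ m N b : ℕ} [NeZero ℓ] [NeZero m] [NeZero b] (hX : b ^ N + 1 ≤ Fintype.card X)
    (hn : 0 < n) {α δ : ℝ} (hα : 0 < α) (hα8 : α ≤ 1 / 8) (hm : 80 * α * n ≤ ℓ * m)
    {A : (Fin n → (Fin ℓ → X) × Bool) → PMF ((Fin ℓ → X) → Bool)} (hDP : IsDP (1 / 2) δ A)
    {H : Set ((Fin ℓ → X) → Bool)} (hH : H ⊆ thresh X ℓ)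
    (hA : IsPACLearner (thresh X ℓ) H α (1 / 8) A) :
    ∃ M, IsMultiSolver ℓ m N (6 / 5) (δ / 5) (21 / 32 - 1 / b) M := by
  have hδ : 0 ≤ δ := hDP.nonneg hn
  have hb : 0 < b := NeZero.pos b
  have hℓ : (0 : ℝ) < ℓ := by exact_mod_cast NeZero.pos ℓ
  have hm' : (0 : ℝ) < m := by exact_mod_cast NeZero.pos m
  obtain ⟨emb, pos, hemb, hpos⟩ := exists_embed X hX
  have hz : ∀ a, emb 0 ≤ a := fun a => (hemb 0 (Nat.zero_le _) a).2 (Nat.zero_le _)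
  obtain ⟨v, hv⟩ := exists_pmf_nullWeight (Fin ℓ × Fin m × Bool) (w := 8 * α) (by linarith)
    (by linarith)
  let pref : (Fin ℓ → Fin m → ℕ) → (Fin ℓ × Fin N → Fin b) → Fin ℓ → Fin m → ℕ :=
    fun x g j i => digitVal (fun k => g (j, k)) / b ^ (x j i + 1)
  -- Row `i` contributes the two ends of the interval of numbers sharing with the secret its digits
  -- above `x j i`: the lower end is positive, the upper end negative. The upper end can be `b ^ N`,
  -- hence the `+ 1` in `hX`.
  let Q : (Fin ℓ → Fin m → ℕ) → (Fin ℓ × Fin N → Fin b) →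
      SampleIdx ℓ m Bool → (Fin ℓ → X) × Bool := fun x g o =>
    o.elim (fun _ => emb 0, true) fun t => (axisPt (emb 0) t.1
      (emb (if t.2.2 then pref x g t.1 t.2.1 * b ^ (x t.1 t.2.1 + 1)
        else (pref x g t.1 t.2.1 + 1) * b ^ (x t.1 t.2.1 + 1))), t.2.2)
  let F : (Fin ℓ → Fin m → ℕ) → (Fin ℓ × Fin N → Fin b) → PMF (Fin ℓ → ℕ) := fun x g =>
    (sampleMech A v (Q x g)).map fun h j => pos (thresholdOf h j)
  refine ⟨fun x => decodeMech (F x), ?_, ?_⟩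
  · rintro x x' ⟨j, i, hx⟩ T
    refine decodeMech_stable _ _ (fun g T => ?_) T
    rw [prob_map, prob_map]
    refine sampleMech_stable hn hδ hDP v {o | ∃ t, o = some (j, i, t)} (q := 8 * α / (ℓ * m))
      ?_ ?_ ?_ _
    · rw [← nullWeight_row (τ := Bool) (8 * α) j i]
      simp only [hv]
    · rw [← mul_div_assoc, div_le_iff₀ (by positivity)]
      linarith
    · rintro (_ | ⟨j', i', t⟩) ho
      · rfl
      · have hne : j' ≠ j ∨ i' ≠ i := by
          by_contra hcon
          push Not at hcon
          exact ho ⟨t, by rw [hcon.1, hcon.2]⟩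
        simp [Q, pref, hx j' i' hne]
  · intro x hx
    -- The secret itself is never a sample point, so digits up to the minimum of `x j` are wholly
    -- invisible: `F' = F`, and the loss is exactly `1 / b`.
    have hsucc := decodeMech_success (e := 1) (δ := 0) (p := 21 / 32) hx (F x) zero_le_one
      (fun g => ?_) fun j k hk => ⟨F x, fun g d => ?_, fun g T => by simp⟩
    · simpa using hsucc
    · have hlt : ∀ j, digitVal (fun k => g (j, k)) < b ^ N := fun j => digitVal_lt _
      have hlo : ∀ j i, pref x g j i * b ^ (x j i + 1) ≤ digitVal fun k => g (j, k) :=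
        fun j i => Nat.div_mul_le_self _ _
      have hhi : ∀ j i, (digitVal fun k => g (j, k)) < (pref x g j i + 1) * b ^ (x j i + 1) := by
        intro j i
        rw [← Nat.div_lt_iff_lt_mul (pow_pos hb _)]
        exact Nat.lt_succ_self _
      have hhiN : ∀ j i, (pref x g j i + 1) * b ^ (x j i + 1) ≤ b ^ N := by
        intro j i
        obtain ⟨c, hc⟩ := pow_dvd_pow b (show x j i + 1 ≤ N from hx j i)
        rw [hc, mul_comm (b ^ (x j i + 1))]
        refine Nat.mul_le_mul_right _ ?_
        rw [Nat.succ_le_iff, Nat.div_lt_iff_lt_mul (pow_pos hb _), mul_comm, ← hc]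
        exact hlt j
      have hc : ∀ ω, threshConcept (fun j => emb (digitVal fun k => g (j, k))) (Q x g ω).1 =
          (Q x g ω).2 := by
        rintro (_ | ⟨j, i, _ | _⟩)
        · exact decide_eq_true fun i => hz _
        · simp only [Q, Option.elim, threshConcept_axisPt hz, decide_eq_false_iff_not,
            Bool.false_eq_true, if_false]
          rw [hemb _ (hhiN j i), hpos _ (hlt j).le, not_le]
          exact hhi j i
        · simp only [Q, Option.elim, threshConcept_axisPt hz, decide_eq_true_eq, if_true]
          rw [hemb _ ((hlo j i).trans (hlt j).le), hpos _ (hlt j).le]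
          exact hlo j i
      have h := sum_prob_coord_ge hα hA ⟨_, rfl⟩ hv (Q x g) hc (r := 1 / 2) (by norm_num)
        (by norm_num)
      refine le_trans (le_of_eq (by ring)) (h.trans (Finset.sum_le_sum fun j _ => ?_))
      rw [prob_map]
      refine prob_mono_support _ ?_
      rintro h ⟨hh, hsup⟩
      have hthr := threshConcept_thresholdOf (hH (support_sampleMech hA v _ hsup))
      -- A good axis has fewer than `m` errors among `2 m` points, so neither the `m` positive nor
      -- the `m` negative ones can all be misclassified. Properness turns this into bounds on the
      -- threshold of `h`.
      have hside : ∀ s : Bool, ∃ i, h (Q x g (some (j, i, s))).1 = s := by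
        intro s
        by_contra hcon
        push Not at hcon
        have hsub : Set.range (fun i : Fin m => (i, s)) ⊆
            {t | h (Q x g (some (j, t))).1 ≠ (Q x g (some (j, t))).2} := by
          rintro _ ⟨i, rfl⟩
          exact hcon i
        have hcard := Set.ncard_le_ncard hsub (Set.toFinite _)
        rw [← Set.image_univ, Set.ncard_image_of_injective _ fun i i' hii => (Prod.mk.inj hii).1,
          Set.ncard_univ, Nat.card_fin] at hcard
        have hcard' : (m : ℝ) ≤ _ := Nat.cast_le.2 hcard
        rw [Set.mem_ofPred_eq, Fintype.card_prod, Fintype.card_fin, Fintype.card_bool] at hh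
        push_cast at hh
        linarith
      refine exists_div_eq_of_window hb ?_ ?_
      · obtain ⟨i, hi⟩ := hside true
        rw [← hthr] at hi
        simp only [Q, Option.elim, threshConcept_axisPt hz, decide_eq_true_eq, if_true] at hi
        rw [hemb _ ((hlo j i).trans (hlt j).le)] at hi
        exact ⟨i, hi⟩
      · obtain ⟨i, hi⟩ := hside false
        rw [← hthr] at hi
        simp only [Q, Option.elim, threshConcept_axisPt hz, decide_eq_false_iff_not,
          Bool.false_eq_true, if_false] at hi
        rw [hemb _ (hhiN j i), not_le] at hi
        exact ⟨i, hi⟩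
    · have hpref : pref x (Function.update g (j, k) d) = pref x g := by
        ext j' i
        refine digitVal_div_congr fun i' hi' => ?_
        rw [Function.update_of_ne]
        intro heq
        obtain ⟨rfl, rfl⟩ := Prod.mk.inj heq
        have := hk i
        omega
      simp only [F, Q, hpref]

/-- The sample complexity of private proper learners for multidimensional thresholds. -/
theorem private_learner_lower_bound {X : Type*} [LinearOrder X] [Fintype X] [Nonempty X]
    {n ℓ : ℕ} {α δ : ℝ} (hα : 0 < α) (hα8 : α ≤ 1 / 8) (hδ : δ * (1500 * (n : ℝ) ^ 2) ≤ (ℓ : ℝ) ^ 2)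
    {A : (Fin n → (Fin ℓ → X) × Bool) → PMF ((Fin ℓ → X) → Bool)} (hDP : IsDP (1 / 2) δ A)
    (hA : IsProperPACLearner (thresh X ℓ) α (1 / 8) A) :
    1 / 768 * ((ℓ : ℝ) / α) * (logStar (Fintype.card X) : ℝ) ≤ (n : ℝ) := by
  obtain ⟨H, hH, hA⟩ := hA
  rcases Nat.eq_zero_or_pos ℓ with rfl | hℓ
  · simp
  rcases lt_or_ge (Fintype.card X) 2 with hX | hX
  · have h0 : logStar (Fintype.card X) = 0 :=
      Nat.le_zero.1 ((logStar_le_iff _ _).2 (by rw [tower]; omega))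
    simp [h0]
  have hnα := le_sixteen_mul_of_learner hℓ hX hα hα8 hA
  have hℓ1 : (0 : ℝ) < ℓ := by exact_mod_cast hℓ
  have hn : 0 < n := by
    rcases Nat.eq_zero_or_pos n with rfl | hn
    · simp only [Nat.cast_zero, mul_zero] at hnα
      linarith
    · exact hn
  have hn1 : (0 : ℝ) < n := by exact_mod_cast hn
  have hδ0 : 0 ≤ δ := hDP.nonneg hn
  have : NeZero ℓ := ⟨hℓ.ne'⟩
  -- About `r` rows per instance make `n` times the row mass at most `1 / 10`. Since `r ≥ 5`,
  -- rounding up costs at most a factor `6 / 5`.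
  set r : ℝ := 80 * α * n / ℓ with hr
  have hr0 : 0 < r := by positivity
  have hr5 : 5 ≤ r := by
    rw [hr, le_div_iff₀ hℓ1]
    linarith
  obtain ⟨k, hk⟩ : ∃ k, ⌈r⌉₊ = k + 1 := Nat.exists_eq_succ_of_ne_zero (Nat.ceil_pos.2 hr0).ne'
  have hkr : r ≤ k + 1 := by
    have := Nat.le_ceil r
    rw [hk] at this
    exact_mod_cast this
  have hkr' : (k + 1 : ℝ) ≤ 6 / 5 * r := by
    have := (Nat.ceil_lt_add_one hr0.le).le
    rw [hk] at this
    push_cast at this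
    linarith
  have hδk : δ * (k + 1) ≤ 1 / 4 := by
    have h1 : r ≤ 10 * n / ℓ := by
      rw [hr]
      gcongr
      nlinarith
    have h2 : δ * (k + 1) ≤ δ * (12 * n / ℓ) := by
      gcongr
      refine hkr'.trans ?_
      calc 6 / 5 * r ≤ 6 / 5 * (10 * n / ℓ) := by gcongr
        _ = 12 * n / ℓ := by ring
    refine h2.trans ?_
    rw [← mul_div_assoc, div_le_iff₀ hℓ1]
    have h3 : (ℓ : ℝ) ≤ 2 * n := by nlinarith
    have h4 : δ * (12 * n) * (125 * n) ≤ 1 / 4 * ℓ * (125 * n) := by nlinarith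
    exact le_of_mul_le_mul_right h4 (by positivity)
  -- Otherwise the success `21/32 - 1/64 ≈ 0.641` would be at most `6/11 + 3/80 + δ (k + 1) / 5`,
  -- which is below `0.634`.
  have hcard : Fintype.card X ≤ 64 ^ hardSize k := by
    by_contra hcon
    obtain ⟨M, hM⟩ := exists_multiSolver_of_learner (m := k + 1) (N := hardSize k) (b := 64)
      (by omega) hn hα hα8 (by
        rw [hr, div_le_iff₀ hℓ1] at hkr
        push_cast
        linarith) hDP hH hA
    have h := hM.le hℓ (by norm_num) k
    have h1 : (0 : ℝ) < 1 / 2 ^ (k + 5) := by positivity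
    have h2 : (6 / 5 + δ / 5) / (1 + 6 / 5) = 6 / 11 + δ / 11 := by ring
    rw [h2] at h
    push_cast at h
    nlinarith
  have hstar : logStar (Fintype.card X) ≤ 2 * (k + 1) + 6 := by
    rw [logStar_le_iff]
    refine hcard.trans (le_trans ?_ (hardSize_le_tower (k + 1)))
    rw [hardSize]
    refine Nat.pow_le_pow_left ?_ _
    calc 64 = 2 ^ 6 := by norm_num
      _ ≤ 2 ^ (k + 6) := Nat.pow_le_pow_right (by norm_num) (by omega)
  have hstar' : (logStar (Fintype.card X) : ℝ) ≤ 8 * (k + 1) := by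
    have : (logStar (Fintype.card X) : ℝ) ≤ 2 * (k + 1) + 6 := by exact_mod_cast hstar
    have hk0 : (0 : ℝ) ≤ k := Nat.cast_nonneg k
    linarith
  -- The constant is `768 = 8 * (6 / 5) * 80`.
  calc 1 / 768 * ((ℓ : ℝ) / α) * (logStar (Fintype.card X) : ℝ)
      ≤ 1 / 768 * ((ℓ : ℝ) / α) * (8 * (6 / 5 * r)) := by gcongr; linarith
    _ = n := by rw [hr]; field_simp; norm_num

end LearnerToSolver

/-! ### The VC dimension of the class. -/

section VCDimension

theorem isVCDim_thresh (X : Type*) [LinearOrder X] [Fintype X] [Nontrivial X] (ℓ : ℕ) :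
    IsVCDim (thresh X ℓ) ℓ := by
  classical
  constructor
  · obtain ⟨lo, hlo⟩ := Finite.exists_min (id : X → X)
    obtain ⟨z, hz⟩ := exists_ne lo
    have hlt : lo < z := lt_of_le_of_ne (hlo z) hz.symm
    let pt : Fin ℓ → Fin ℓ → X := fun j => Function.update (fun _ => lo) j z
    have hinj : Function.Injective pt := by
      intro i j hij
      by_contra hne
      have := congrFun hij i
      simp only [pt, Function.update_self, Function.update_of_ne hne] at this
      exact hz this
    refine ⟨Finset.univ.image pt, fun T _ => ?_, ?_⟩
    · refine ⟨_, ⟨fun j => if pt j ∈ T then z else lo, rfl⟩, fun x hx => ?_⟩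
      obtain ⟨j, _, rfl⟩ := Finset.mem_image.1 hx
      rw [threshConcept, decide_eq_true_eq]
      refine ⟨fun h => ?_, fun h i => ?_⟩
      · by_contra hT
        have := h j
        simp only [pt, Function.update_self] at this hT
        rw [if_neg hT] at this
        exact absurd this (not_le.2 hlt)
      · by_cases hij : i = j
        · subst hij
          simp only [h, if_true]
          simp [pt]
        · simp only [pt, Function.update_of_ne hij]
          exact hlo _
    · rw [Finset.card_image_of_injective _ hinj, Finset.card_univ, Fintype.card_fin]
  · rintro k ⟨S, hS, rfl⟩
    by_contra hlt
    rw [not_le] at hlt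
    have hne : S.Nonempty := Finset.card_pos.1 (by omega)
    -- If a maximizer of every coordinate is labeled positive, then all of `S` is; with more than
    -- `ℓ` points some labeling is therefore missed.
    have hmax : ∀ i : Fin ℓ, ∃ x ∈ S, ∀ y ∈ S, y i ≤ x i := fun i =>
      Finset.exists_max_image S (fun x => x i) hne
    choose top htop hmax using hmax
    set T := Finset.univ.image top with hT
    have hTS : T ⊆ S := by
      intro x hx
      obtain ⟨i, _, rfl⟩ := Finset.mem_image.1 hx
      exact htop i
    have hTcard : T.card < S.card := by
      refine lt_of_le_of_lt Finset.card_image_le ?_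
      rwa [Finset.card_univ, Fintype.card_fin]
    obtain ⟨y, hyS, hyT⟩ := Finset.exists_mem_notMem_of_card_lt_card hTcard
    obtain ⟨_, ⟨a, rfl⟩, ha⟩ := hS T hTS
    refine hyT ((ha y hyS).1 ?_)
    rw [threshConcept, decide_eq_true_eq]
    intro i
    have hi := (ha (top i) (htop i)).2 (Finset.mem_image_of_mem _ (Finset.mem_univ i))
    rw [threshConcept, decide_eq_true_eq] at hi
    exact (hmax i y hyS).trans (hi i)

end VCDimension

/-! ### Learning without privacy by the smallest consistent box. -/

section NonPrivateLearner

/-- The corner of the smallest box which contains the positive examples. -/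
noncomputable def boxCorner {X : Type*} [LinearOrder X] {ℓ n : ℕ} (lo : X)
    (S : Fin n → (Fin ℓ → X) × Bool) : Fin ℓ → X := fun k =>
  Finset.univ.fold max lo fun i => if (S i).2 then (S i).1 k else lo

theorem le_boxCorner {X : Type*} [LinearOrder X] {ℓ n : ℕ} (lo : X)
    (S : Fin n → (Fin ℓ → X) × Bool) (k : Fin ℓ) {i : Fin n} (hi : (S i).2 = true) :
    (S i).1 k ≤ boxCorner lo S k := by
  rw [boxCorner, Finset.le_fold_max]
  exact Or.inr ⟨i, Finset.mem_univ i, by simp [hi]⟩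

theorem boxCorner_le {X : Type*} [LinearOrder X] {ℓ n : ℕ} {lo : X} (hlo : ∀ a, lo ≤ a)
    (a : Fin ℓ → X) (zs : Fin n → Fin ℓ → X) (k : Fin ℓ) :
    boxCorner lo (fun i => (zs i, threshConcept a (zs i))) k ≤ a k := by
  rw [boxCorner, Finset.fold_max_le]
  refine ⟨hlo _, fun i _ => ?_⟩
  dsimp only
  split_ifs with h
  · rw [threshConcept, decide_eq_true_eq] at h
    exact h k
  · exact hlo _

/-- The `i`-th example is misclassified by the smallest box of the others. -/
def IsLeftOut {X : Type*} [LinearOrder X] {ℓ n : ℕ} (a : Fin ℓ → X) (s : Fin n → Fin ℓ → X)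
    (i : Fin n) : Prop :=
  threshConcept a (s i) = true ∧
    ∃ k, ∀ i', i' ≠ i → threshConcept a (s i') = true → s i' k < s i k

/-- A coordinate can witness for at most one example, the strict maximum of the positive ones there.
-/
theorem ncard_isLeftOut_le {X : Type*} [LinearOrder X] {ℓ n : ℕ} (a : Fin ℓ → X)
    (s : Fin n → Fin ℓ → X) : ({i | IsLeftOut a s i} : Set (Fin n)).ncard ≤ ℓ := by
  rcases isEmpty_or_nonempty (Fin ℓ) with hE | hE
  · have : ({i | IsLeftOut a s i} : Set (Fin n)) = ∅ :=
      Set.eq_empty_iff_forall_notMem.2 fun i hi => hE.elim hi.2.choose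
    simp [this]
  choose! k hk using fun i (h : IsLeftOut a s i) => h.2
  have h := Set.ncard_le_ncard_of_injOn (s := {i | IsLeftOut a s i}) (t := Set.univ) k
    (fun _ _ => Set.mem_univ _) (fun i hi i' hi' hkk => ?_) (Set.toFinite _)
  · simpa using h
  · by_contra hne
    have h1 := hk i hi i' (Ne.symm hne) hi'.1
    have h2 := hk i' hi' i hne hi.1
    rw [hkk] at h1
    exact lt_asymm h1 h2

theorem isLeftOut_of_ne {X : Type*} [LinearOrder X] {ℓ n : ℕ} {lo : X} (hlo : ∀ a, lo ≤ a)
    (a : Fin ℓ → X) (z : Fin ℓ → X) (zs : Fin n → Fin ℓ → X)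
    (h : threshConcept (boxCorner lo fun i => (zs i, threshConcept a (zs i))) z ≠
      threshConcept a z) : IsLeftOut a (Fin.cons z zs : Fin (n + 1) → Fin ℓ → X) 0 := by
  set c := boxCorner lo fun i => (zs i, threshConcept a (zs i)) with hc
  have hca : ∀ k, c k ≤ a k := boxCorner_le hlo a zs
  have hz : threshConcept a z = true := by
    by_contra hz
    rw [Bool.not_eq_true] at hz
    refine h (hz ▸ ?_)
    rw [threshConcept, decide_eq_false_iff_not] at hz ⊢
    exact fun h' => hz fun k => (h' k).trans (hca k)
  rw [hz, Ne, threshConcept, decide_eq_true_eq] at h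
  push Not at h
  obtain ⟨k, hk⟩ := h
  refine ⟨by simpa using hz, k, fun i' hi' hpos => ?_⟩
  obtain ⟨i, rfl⟩ := Fin.exists_succ_eq.2 hi'
  rw [Fin.cons_succ] at hpos ⊢
  rw [Fin.cons_zero]
  exact (le_boxCorner lo (fun i => (zs i, threshConcept a (zs i))) k hpos).trans_lt hk

open Classical in
-- By exchangeability all `n + 1` examples are left out with equal probability, and at most `ℓ` of
-- them are at once.
theorem iidExp_isLeftOut_le {X : Type*} [LinearOrder X] [Fintype X] {ℓ n : ℕ} (a : Fin ℓ → X)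
    {v : (Fin ℓ → X) → ℝ} (hv : ∀ z, 0 ≤ v z) (hs : ∑ z, v z = 1) :
    (n + 1) * iidExp v (fun s : Fin (n + 1) → Fin ℓ → X => if IsLeftOut a s 0 then 1 else 0) ≤
      ℓ := by
  have hsymm : ∀ i : Fin (n + 1),
      iidExp v (fun s : Fin (n + 1) → Fin ℓ → X => if IsLeftOut a s i then 1 else 0) =
      iidExp v (fun s : Fin (n + 1) → Fin ℓ → X => if IsLeftOut a s 0 then 1 else 0) := by
    intro i
    rw [← iidExp_perm v _ (Equiv.swap 0 i)]
    congr 1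
    ext s
    congr 1
    simp only [IsLeftOut, Function.comp_apply, Equiv.swap_apply_right, eq_iff_iff]
    refine and_congr_right fun _ => exists_congr fun k => ?_
    rw [← (Equiv.swap 0 i).forall_congr_right]
    refine forall_congr' fun i' => ?_
    simp [Equiv.swap_apply_eq_iff]
  have h1 : iidExp v (fun s : Fin (n + 1) → Fin ℓ → X =>
      ∑ i ∈ Finset.univ, if IsLeftOut a s i then (1 : ℝ) else 0) ≤
      iidExp v (fun _ : Fin (n + 1) → Fin ℓ → X => (ℓ : ℝ)) := by
    refine iidExp_mono hv fun s => ?_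
    have := ncard_isLeftOut_le a s
    rw [Set.ncard_eq_toFinset_card'] at this
    rw [Finset.sum_boole]
    norm_cast
    refine le_trans (le_of_eq ?_) this
    congr 1
    ext i
    simp
  rw [iidExp_sum, iidExp_const, hs, one_pow, one_mul] at h1
  simp only [hsymm] at h1
  simpa using h1

/-- Returning the smallest consistent box learns thresholds from `O(ℓ)` samples. -/
theorem isPACLearner_boxCorner {X : Type*} [LinearOrder X] [Fintype X] {ℓ n : ℕ}
    {lo : X} (hlo : ∀ a, lo ≤ a) {α β : ℝ} (hα : 0 < α) (hn : (ℓ : ℝ) ≤ α * β * (n + 1)) :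
    IsPACLearner (n := n) (thresh X ℓ) (thresh X ℓ) α β
      fun S => PMF.pure (threshConcept (boxCorner lo S)) := by
  classical
  constructor
  · intro S h hh
    rw [PMF.mem_support_pure_iff] at hh
    exact hh ▸ ⟨_, rfl⟩
  · rintro _ ⟨a, rfl⟩ D
    set v : (Fin ℓ → X) → ℝ := fun z => (D z).toReal with hv
    have hv0 : ∀ z, 0 ≤ v z := fun _ => ENNReal.toReal_nonneg
    have hv1 : ∑ z, v z = 1 := sum_toReal_eq_one D
    set err : (Fin n → Fin ℓ → X) → ℝ := fun zs => genError D (threshConcept a)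
      (threshConcept (boxCorner lo fun i => (zs i, threshConcept a (zs i)))) with herr
    have herr0 : ∀ zs, 0 ≤ err zs := fun zs => prob_nonneg _ _
    have hexp : iidExp v err ≤
        iidExp v (fun s : Fin (n + 1) → Fin ℓ → X => if IsLeftOut a s 0 then 1 else 0) := by
      have h1 : ∀ zs, err zs ≤ ∑ z, v z *
          if IsLeftOut a (Fin.cons z zs : Fin (n + 1) → Fin ℓ → X) 0 then 1 else 0 := by
        intro zs
        simp only [herr, genError]
        rw [prob_eq_sum]
        refine Finset.sum_le_sum fun z _ => ?_
        by_cases hz : z ∈ {z | threshConcept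
            (boxCorner lo fun i => (zs i, threshConcept a (zs i))) z ≠ threshConcept a z}
        · rw [if_pos hz, if_pos (isLeftOut_of_ne hlo a z zs hz), mul_one]
        · rw [if_neg hz]
          exact mul_nonneg (hv0 z) (by split_ifs <;> norm_num)
      refine (iidExp_mono hv0 h1).trans_eq ?_
      rw [iidExp_sum, iidExp_succ]
      refine Finset.sum_congr rfl fun z _ => ?_
      simpa using iidExp_affine v hv1 (fun zs : Fin n → Fin ℓ → X =>
        if IsLeftOut a (Fin.cons z zs : Fin (n + 1) → Fin ℓ → X) 0 then (1 : ℝ) else 0) (v z) 0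
    -- Markov's inequality: the failure indicator is at most `err / α`.
    have hmarkov : iidExp v (fun zs => if err zs ≤ α then 0 else 1) ≤ α⁻¹ * iidExp v err := by
      have h := iidExp_affine v hv1 err α⁻¹ 0
      simp only [add_zero] at h
      rw [← h]
      refine iidExp_mono hv0 fun zs => ?_
      split_ifs with hle
      · exact mul_nonneg (inv_nonneg.2 hα.le) (herr0 zs)
      · rw [inv_mul_eq_div, le_div_iff₀ hα]
        linarith
    have hβ : α⁻¹ * iidExp v err ≤ β := by
      have h2 := iidExp_isLeftOut_le (n := n) a hv0 hv1
      have h3 : (0 : ℝ) < n + 1 := by positivity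
      rw [inv_mul_eq_div, div_le_iff₀ hα]
      have h4 : (n + 1) * iidExp v err ≤ (n + 1) * (β * α) := by
        refine (mul_le_mul_of_nonneg_left hexp h3.le).trans (h2.trans (hn.trans_eq ?_))
        ring
      exact le_of_mul_le_mul_left h4 h3
    rw [prob_iidSample_bind]
    have hpure : ∀ zs, prob (PMF.pure (threshConcept
        (boxCorner lo fun i => (zs i, threshConcept a (zs i)))))
        {h | genError D (threshConcept a) h ≤ α} = -1 * (if err zs ≤ α then 0 else 1) + 1 := by
      intro zs
      rw [prob, PMF.toOuterMeasure_pure_apply]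
      by_cases hle : err zs ≤ α
      · rw [if_pos hle, if_pos (show _ ∈ {h | genError D (threshConcept a) h ≤ α} from hle)]
        simp
      · rw [if_neg hle, if_neg (show _ ∉ {h | genError D (threshConcept a) h ≤ α} from hle)]
        simp
    simp only [hpure]
    rw [iidExp_affine v hv1]
    linarith

theorem exists_properLearner (α β : ℝ) (hα : 0 < α) (hβ : 0 < β) : ∃ K : ℕ,
    ∀ (X : Type*) [LinearOrder X] [Fintype X] [Nonempty X] (ℓ : ℕ),
      ∃ n ≤ K * ℓ, ∃ A : (Fin n → (Fin ℓ → X) × Bool) → PMF ((Fin ℓ → X) → Bool),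
        IsProperPACLearner (thresh X ℓ) α β A := by
  refine ⟨⌈(α * β)⁻¹⌉₊, fun X _ _ _ ℓ => ?_⟩
  obtain ⟨lo, hlo⟩ := Finite.exists_min (id : X → X)
  refine ⟨_, le_rfl, _, thresh X ℓ, le_rfl, isPACLearner_boxCorner hlo hα ?_⟩
  have hK := Nat.le_ceil (α * β)⁻¹
  have hαβ : 0 < α * β := mul_pos hα hβ
  rw [inv_le_iff_one_le_mul₀' hαβ] at hK
  push_cast
  have hℓ : (0 : ℝ) ≤ ℓ := Nat.cast_nonneg ℓ
  nlinarith

end NonPrivateLearner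

theorem mainTheorem7 :
    -- the lower bound for private proper learners
    (∃ lam : ℝ, 0 < lam ∧
      ∀ (X : Type*) [LinearOrder X] [Fintype X] [Nonempty X] (n ℓ : ℕ) (α δ : ℝ),
        0 < α → α ≤ 1 / 8 → δ * (1500 * (n : ℝ) ^ 2) ≤ (ℓ : ℝ) ^ 2 →
        ∀ A : (Fin n → (Fin ℓ → X) × Bool) → PMF ((Fin ℓ → X) → Bool),
          IsDP (1 / 2) δ A → IsProperPACLearner (thresh X ℓ) α (1 / 8) A →
            lam * ((ℓ : ℝ) / α) * (logStar (Fintype.card X) : ℝ) ≤ (n : ℝ)) ∧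
    -- the VC dimension of the class
    (∀ (X : Type*) [LinearOrder X] [Fintype X] [Nontrivial X] (ℓ : ℕ),
      IsVCDim (thresh X ℓ) ℓ) ∧
    -- without privacy, a number of samples linear in `ℓ` suffices for proper learning
    (∀ α β : ℝ, 0 < α → 0 < β → ∃ K : ℕ,
      ∀ (X : Type*) [LinearOrder X] [Fintype X] [Nonempty X] (ℓ : ℕ),
        ∃ n ≤ K * ℓ, ∃ A : (Fin n → (Fin ℓ → X) × Bool) → PMF ((Fin ℓ → X) → Bool),
          IsProperPACLearner (thresh X ℓ) α β A) := by
  refine ⟨⟨1 / 768, by norm_num, ?_⟩, ?_, exists_properLearner⟩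
  · intro X _ _ _ n ℓ α δ hα hα8 hδ A hDP hA
    exact private_learner_lower_bound hα hα8 hδ hDP hA
  · intro X _ _ _ ℓ
    exact isVCDim_thresh X ℓ
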